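/- **Conventions.** $\mathrm{Cat}$ is the category of small categories and functors, $e$ its terminal object, and $\mathrm{Grpd}$ the category of small groupoids. For a functor $u\colon A\to B$ and an object $b$ of $B$, $A/b$ is the category of pairs $(a,\,q\colon u(a)\to b)$, with morphisms $(a,q)\to(a',q')$ the $f\colon a\to a'$ such that $q'\circ u(f)=q$; for $u=\mathrm{id}_A$ this is the slice $A/a$. A class $\mathcal W$ of morphisms of $\mathrm{Cat}$ is a *basic localizer* if 1. $\mathcal W$ contains all isomorphisms, satisfies 2-out-of-3, and, whenever $i\colon X\to Y$ and $r\colon Y\to X$ are functors with $ri=\mathrm{id}_X$ and $ir\in\mathcal W$, then $r\in\mathcal W$; 2. $A\to e$ is in $\mathcal W$ for every small category $A$ with a terminal object; 3. if $u\colon A\to B$ is a functor over a small category $C$ and for every object $c$ of $C$ the induced functor $A/c\to B/c$ is in $\mathcal W$, then $u\in\mathcal W$. Fix a basic localizer $\mathcal W$. A small category $A$ is *aspherical* if $A\to e$ is in $\mathcal W$; a functor $u\colon A\to B$ is *aspherical* if $A/b$ is aspherical for every object $b$ of $B$; $A$ is *totally aspherical* if $A$ and its diagonal functor $A\to A\times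 A$ are aspherical. Given categories equipped with classes of weak equivalences, an adjunction $L\dashv R$ is a *homotopical equivalence* if $L$ and $R$ preserve weak equivalences and every component of the unit and of the counit is a weak equivalence. Let $A$ be a small category. * For a presheaf of sets $X$ on $A$, let $i_A(X)$ be its category of elements: the objects are the pairs $(a,x)$ with $a\in A$, $x\in X(a)$, and a morphism $(a,x)\to(a',x')$ is an $f\colon a\to a'$ with $x=X(f)(x')$. The functor $i_A$ from presheaves of sets on $A$ to $\mathrm{Cat}$ has the right adjoint $i_A^*(C)=\bigl(a\mapsto \mathrm{Hom}_{\mathrm{Cat}}(A/a,C)\bigr)$. A morphism $\varphi$ of presheaves of sets is a weak equivalence if $i_A(\varphi)\in\mathcal W$. * For a presheaf of groupoids $X$ on $A$, that is, a strict functor $A^{\mathrm{op}}\to\mathrm{Grpd}$ (morphisms being strict natural transformations), let $I_A(X)$ be its Grothendieck construction: the objects are the pairs $(a,x)$ with $a\in A$ and $x$ an object of $X(a)$, a morphism $(a,x)\to(a',x')$ is a pair $(f,k)$ with $f\colon a\to a'$ in $A$ and $k\colon x\to X(f)(x')$ in $X(a)$, and $(f',k')\circ(f,k)=(f'f,\,X(f)(k')\circ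 k)$. The functor $I_A$ from presheaves of groupoids on $A$ to $\mathrm{Cat}$ has the right adjoint $I_A^*(C)=\bigl(a\mapsto\underline{\mathrm{Iso}}(A/a,C)\bigr)$, where $\underline{\mathrm{Iso}}(A/a,C)$ is the groupoid of functors $A/a\to C$ and natural isomorphisms. A morphism $\varphi$ of presheaves of groupoids is a weak equivalence if $I_A(\varphi)\in\mathcal W$. $\mathrm{Cat}$ is equipped with the class $\mathcal W$. The category $A$ is *weak test* (resp. *groupoidal weak test*) if $i_A\dashv i_A^*$ (resp. $I_A\dashv I_A^*$) is a homotopical equivalence; *local test* (resp. *groupoidal local test*) if $A/a$ is weak test (resp. groupoidal weak test) for every object $a$ of $A$; *test* (resp. *groupoidal test*) if it is both weak test and local test (resp. both groupoidal weak test and groupoidal local test); *strict test* (resp. *groupoidal strict test*) if it is totally aspherical and test (resp. totally aspherical and groupoidal test). **Theorem.** For every basic localizer $\mathcal W$ and every small category $A$: (a) $A$ is groupoidal local test if and only if $A$ is local test; (b) $A$ is groupoidal test if and only if $A$ is test; (c) $A$ is groupoidal strict test if and only if $A$ is strict test. -/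

import Mathlib

open CategoryTheory Opposite

universe u

namespace TestCat

noncomputable section

/-! ### Basic localizers of the category of small categories -/

/-- The functor `A ⥤ e` to the terminal category `e`, as a morphism of `Cat`. -/
def toPoint (A : Type u) [SmallCategory A] : Cat.of A ⟶ Cat.of (Discrete PUnit.{u + 1}) :=
  (Functor.star A).toCatHom

/-- `(C, W)` is a category with weak equivalences: `W` contains all isomorphisms and has the
two-out-of-three property. -/
structure IsWeakEquivalences {C : Type*} [Category C] (W : MorphismProperty C) : Prop where
  iso_mem : ∀ {X Y : C} (f : X ⟶ Y), IsIso f → W f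
  twoOutOfThree : W.HasTwoOutOfThreeProperty

/-- `W` is weakly saturated: it is a class of weak equivalences and, whenever `ri` is an identity
and `ir ∈ W` (compositions read from right to left), then `r ∈ W`. -/
structure IsWeaklySaturated {C : Type*} [Category C] (W : MorphismProperty C) : Prop extends
    IsWeakEquivalences W where
  retraction_mem : ∀ {X Y : C} (i : X ⟶ Y) (r : Y ⟶ X), i ≫ r = 𝟙 X → W (r ≫ i) → W r

/-- `W` is a basic localizer. In the last axiom `CostructuredArrow v c` is the slice `A/c`, for
`v : A ⥤ C` and `c` an object of `C`, and `CostructuredArrow.pre f w c` is the functor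
`A/c ⥤ B/c` induced by the commutative triangle formed by `f`, `w` and `f ⋙ w`. -/
structure IsBasicLocalizer (W : MorphismProperty Cat.{u, u}) : Prop extends
    IsWeaklySaturated W where
  toPoint_mem : ∀ (A : Type u) [SmallCategory A], Limits.HasTerminal A → W (toPoint A)
  of_slices : ∀ {A B C : Type u} [SmallCategory A] [SmallCategory B] [SmallCategory C]
    (f : A ⥤ B) (w : B ⥤ C),
    (∀ c : C, W (CostructuredArrow.pre f w c).toCatHom) → W f.toCatHom

section

variable (W : MorphismProperty Cat.{u, u})

/-- A small category is `W`-aspherical if the functor to the terminal category is in `W`. -/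
def IsAspherical (A : Type u) [SmallCategory A] : Prop :=
  W (toPoint A)

/-- A functor `u : A ⥤ B` is `W`-aspherical if every slice `A/b` is `W`-aspherical. -/
def IsAsphericalFunctor {A B : Type u} [SmallCategory A] [SmallCategory B] (u : A ⥤ B) : Prop :=
  ∀ b : B, IsAspherical W (CostructuredArrow u b)

/-- `A` is totally `W`-aspherical: `A` and its diagonal functor are `W`-aspherical. -/
structure IsTotallyAspherical (A : Type u) [SmallCategory A] : Prop where
  aspherical : IsAspherical W A
  diag : IsAsphericalFunctor W (Functor.diag A)

end

/-- The adjunction `L ⊣ R` is a homotopical equivalence between `(C, W)` and `(D, W')`. -/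
structure IsHomotopicalEquivalence {C D : Type*} [Category C] [Category D]
    (W : MorphismProperty C) (W' : MorphismProperty D) {L : C ⥤ D} {R : D ⥤ C} (adj : L ⊣ R) :
    Prop where
  left_mem : ∀ {X Y : C} (f : X ⟶ Y), W f → W' (L.map f)
  right_mem : ∀ {X Y : D} (f : X ⟶ Y), W' f → W (R.map f)
  counit_mem : ∀ X : D, W' (adj.counit.app X)
  unit_mem : ∀ Y : C, W (adj.unit.app Y)

/-! ### Evaluating functors on slices at the terminal object -/

section Slices

variable {A : Type u} [SmallCategory A] {C : Type u} [SmallCategory C]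

/-- The morphism `f ⟶ 𝟙 a'` of `A/a'` given by `f : a ⟶ a'`. -/
def toId {a a' : A} (f : a ⟶ a') : (Over.map f).obj (Over.mk (𝟙 a)) ⟶ Over.mk (𝟙 a') :=
  Over.homMk f (by simp)

lemma toId_id (a : A) : toId (𝟙 a) = eqToHom (by rw [Over.mapId_eq]; rfl) := by
  ext
  simp [Over.eqToHom_left, toId]

lemma toId_comp {a a' a'' : A} (f : a ⟶ a') (g : a' ⟶ a'') :
    toId (f ≫ g) =
      eqToHom (by rw [Over.mapComp_eq]; rfl) ≫ (Over.map g).map (toId f) ≫ toId g := by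
  ext
  simp [Over.eqToHom_left, toId]

/-- For `f : a ⟶ a'`, functors `p : A/a ⥤ C` and `p' : A/a' ⥤ C` and a natural transformation `σ`
from `p` to the restriction of `p'` along `f`, the composite of the component
`p(𝟙 a) ⟶ p'(f)` of `σ` with the image `p'(f) ⟶ p'(𝟙 a')` of the morphism `f ⟶ 𝟙 a'` of `A/a'`. -/
def evalMap {a a' : A} {p : Over a ⥤ C} {p' : Over a' ⥤ C} (f : a ⟶ a')
    (σ : p ⟶ Over.map f ⋙ p') : p.obj (Over.mk (𝟙 a)) ⟶ p'.obj (Over.mk (𝟙 a')) :=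
  σ.app (Over.mk (𝟙 a)) ≫ p'.map (toId f)

lemma evalMap_id {a : A} {p : Over a ⥤ C} (h : p = Over.map (𝟙 a) ⋙ p) :
    evalMap (𝟙 a) (eqToHom h) = 𝟙 _ := by
  rw [evalMap, toId_id, eqToHom_map, eqToHom_app, eqToHom_trans, eqToHom_refl]

lemma evalMap_comp {a a' a'' : A} {p : Over a ⥤ C} {p' : Over a' ⥤ C} {p'' : Over a'' ⥤ C}
    (f : a ⟶ a') (g : a' ⟶ a'') (σ : p ⟶ Over.map f ⋙ p') (τ : p' ⟶ Over.map g ⋙ p'') :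
    evalMap (f ≫ g) (σ ≫ (Over.map f).whiskerLeft τ ≫
      eqToHom (by rw [Over.mapComp_eq]; rfl)) = evalMap f σ ≫ evalMap g τ := by
  have h := τ.naturality (toId f)
  rw [evalMap, evalMap, evalMap, toId_comp]
  simp only [Category.assoc, Functor.map_comp, NatTrans.comp_app, reassoc_of% h, eqToHom_app,
    eqToHom_map, Functor.whiskerLeft_app, eqToHom_trans_assoc, eqToHom_refl, Category.id_comp]

lemma evalMap_eqToHom_of_obj {a a' : A} {p : Over a ⥤ C} {p' : Over a' ⥤ C} (f : a ⟶ a')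
    (h : p = Over.map f ⋙ p')
    (h' : p.obj (Over.mk (𝟙 a)) = p'.obj ((Over.map f).obj (Over.mk (𝟙 a)))) :
    evalMap f (eqToHom h) = eqToHom h' ≫ p'.map (toId f) := by
  simp [evalMap, eqToHom_app]

lemma map_evalMap' {D : Type u} [SmallCategory D] (F : C ⥤ D) {a a' : A} {p : Over a ⥤ C}
    {p' : Over a' ⥤ C} (f : a ⟶ a') (τ : p ⋙ F ⟶ Over.map f ⋙ p' ⋙ F)
    (σ : p ⟶ Over.map f ⋙ p') (h : τ = Functor.whiskerRight σ F) :
    evalMap (p := p ⋙ F) (p' := p' ⋙ F) f τ = F.map (evalMap f σ) := by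
  subst h
  simp [evalMap]

lemma map_evalMap {D : Type u} [SmallCategory D] (F : C ⥤ D) {a a' : A} {p : Over a ⥤ C}
    {p' : Over a' ⥤ C} (f : a ⟶ a') (h : p = Over.map f ⋙ p') :
    F.map (evalMap f (eqToHom h)) =
      evalMap (p := p ⋙ F) (p' := p' ⋙ F) f (eqToHom (by rw [h]; rfl)) := by
  simp [evalMap, eqToHom_map, eqToHom_app]

lemma obj_mk_id {a : A} (g : Over a) : (Over.map g.hom).obj (Over.mk (𝟙 g.left)) = g :=
  congrArg (Over.mk (Y := g.left)) (Category.id_comp g.hom)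

lemma evalMap_restrict {a : A} (p : Over a ⥤ C) {g g' : Over a} (h : g ⟶ g')
    (e : Over.map g.hom ⋙ p = Over.map h.left ⋙ Over.map g'.hom ⋙ p) :
    evalMap h.left (eqToHom e) =
      eqToHom (congrArg p.obj (obj_mk_id g)) ≫ p.map h ≫
        eqToHom (congrArg p.obj (obj_mk_id g')).symm := by
  have e' : (Over.map g.hom).obj (Over.mk (𝟙 g.left)) =
      (Over.map g'.hom).obj ((Over.map h.left).obj (Over.mk (𝟙 g.left))) :=
    congrArg (Over.mk (Y := g.left)) (by simp)
  have : h = eqToHom (obj_mk_id g).symm ≫ eqToHom e' ≫ (Over.map g'.hom).map (toId h.left) ≫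
      eqToHom (obj_mk_id g') := by
    ext
    simp [Over.eqToHom_left, toId]
  rw [evalMap, eqToHom_app]
  conv_rhs => rw [this]
  simp [eqToHom_map]

end Slices

/-! ### Presheaves of sets -/

section Presheaves

variable (A : Type u) [SmallCategory A]

/-- The functor `i_A`, sending a presheaf `X` to its category of elements `A/X`. In Mathlib a
morphism from `(a, x)` to `(a', x')` in `X.Elements` is a morphism `f` of `Aᵒᵖ` such that
`X(f)(x) = x'`, whence the opposite category. -/
def iA : (Aᵒᵖ ⥤ Type u) ⥤ Cat.{u, u} :=
  Functor.elementsFunctor ⋙ Cat.opFunctor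

/-- The functor `i_A^*`, sending `C` to the presheaf `a ↦ Hom(A/a, C)`. -/
def iAStar : Cat.{u, u} ⥤ (Aᵒᵖ ⥤ Type u) :=
  yoneda ⋙ (Functor.whiskeringLeft _ _ _).obj (Over.mapFunctor A).op

variable {A}

/-- For `x ∈ X(a)`, the functor `A/a ⥤ A/X` sending `g : b ⟶ a` to `(b, X(g)(x))`. -/
def iAUnitObj (X : Aᵒᵖ ⥤ Type u) {a : A} (x : X.obj (op a)) : Over a ⥤ X.Elementsᵒᵖ where
  obj g := op ⟨op g.left, X.map g.hom.op x⟩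
  map {g g'} h := Quiver.Hom.op (CategoryOfElements.homMk _ _ h.left.op (by
    rw [← Over.w h, op_comp, Functor.map_comp]; rfl))

/-- A section of `i_A^* C` over `a`, as a functor `A/a ⥤ C`. -/
def sliceFunctor {C : Cat.{u, u}} {a : A} (p : ((iAStar A).obj C).obj (op a)) : Over a ⥤ C :=
  Cat.Hom.toFunctor (C := Cat.of (Over a)) p

lemma sliceFunctor_eq {C : Cat.{u, u}} {z z' : ((iAStar A).obj C).Elementsᵒᵖ} (f : z ⟶ z') :
    sliceFunctor z.unop.2 = Over.map f.unop.val.unop ⋙ sliceFunctor z'.unop.2 :=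
  congrArg sliceFunctor f.unop.2.symm

/-- The functor `i_A i_A^* C ⥤ C` sending `(a, p : A/a ⥤ C)` to `p(𝟙 a)`. -/
def iACounitFunctor (C : Cat.{u, u}) : ((iAStar A).obj C).Elementsᵒᵖ ⥤ C where
  obj z := (sliceFunctor z.unop.2).obj (Over.mk (𝟙 _))
  map f := evalMap f.unop.val.unop (eqToHom (sliceFunctor_eq f))
  map_id z := evalMap_id _
  map_comp {z z' z''} f g := by
    rw [← evalMap_comp]
    have : (Over.map f.unop.val.unop).whiskerLeft (eqToHom (sliceFunctor_eq g)) =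
      eqToHom (by rw [← sliceFunctor_eq g]) := by
      ext; simp [eqToHom_app]
    rw [this, eqToHom_trans, eqToHom_trans]
    rfl

lemma functor_ext_of_faithful {D E B : Type*} [Category D] [Category E] [Category B] {F G : D ⥤ E}
    (P : E ⥤ B) [P.Faithful] (hobj : ∀ x, F.obj x = G.obj x) (h : F ⋙ P = G ⋙ P) : F = G :=
  CategoryTheory.Functor.ext hobj fun x y f => P.map_injective (by
    simpa [eqToHom_map] using Functor.congr_hom h f)

lemma elements_functor_ext {D : Type*} [Category D] {X : Aᵒᵖ ⥤ Type u} {F G : D ⥤ X.Elementsᵒᵖ}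
    (hobj : ∀ x, F.obj x = G.obj x)
    (h : F ⋙ (CategoryOfElements.π X).leftOp = G ⋙ (CategoryOfElements.π X).leftOp) : F = G :=
  functor_ext_of_faithful _ hobj h

lemma iAUnitObj_map (X : Aᵒᵖ ⥤ Type u) {a a' : A} (f : a ⟶ a') (x : X.obj (op a')) :
    iAUnitObj X (X.map f.op x) = Over.map f ⋙ iAUnitObj X x := by
  refine elements_functor_ext (fun g => ?_) rfl
  change op (X.elementsMk _ _) = op (X.elementsMk _ _)
  simp

lemma iAUnitObj_eq {X : Aᵒᵖ ⥤ Type u} {z z' : X.Elementsᵒᵖ} (f : z ⟶ z') :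
    iAUnitObj X z.unop.2 = Over.map f.unop.val.unop ⋙ iAUnitObj X z'.unop.2 := by
  rw [← iAUnitObj_map]
  exact congrArg (iAUnitObj X) f.unop.2.symm

/-- The adjunction between `i_A` and `i_A^*`. -/
def iAAdj (A : Type u) [SmallCategory A] : iA A ⊣ iAStar A where
  unit :=
    { app := fun X =>
        { app := fun a => TypeCat.ofHom fun x => (iAUnitObj X (a := a.unop) x).toCatHom
          naturality := by
            intro a a' f
            ext x
            exact Cat.ext (iAUnitObj_map X f.unop x) }
      naturality := by
        intro X Y α
        ext a x
        refine Cat.ext (elements_functor_ext (fun g => ?_) rfl)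
        change op (Y.elementsMk _ _) = op (Y.elementsMk _ _)
        exact congrArg (fun y => op (Y.elementsMk _ y)) (NatTrans.naturality_apply α _ x).symm }
  counit :=
    { app := fun C => (iACounitFunctor C).toCatHom
      naturality := by
        intro C D F
        refine Cat.ext (CategoryTheory.Functor.ext (fun _ => rfl) (fun z z' f => ?_))
        erw [Category.comp_id, Category.id_comp]
        exact (map_evalMap F.toFunctor _ _).symm }
  left_triangle_components := by
    intro X
    refine Cat.ext (elements_functor_ext (fun z => ?_) ?_)
    · obtain ⟨⟨⟨a⟩, x⟩⟩ := z
      change op (X.elementsMk _ (X.map (𝟙 (op a)) x)) = op (X.elementsMk _ x)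
      simp
    · refine CategoryTheory.Functor.ext (fun _ => rfl) (fun z z' f => ?_)
      erw [Category.comp_id, Category.id_comp]
      refine (map_evalMap (C := X.Elementsᵒᵖ) (CategoryOfElements.π X).leftOp f.unop.val.unop
        (iAUnitObj_eq f)).trans ?_
      simp [evalMap]
      exact Category.id_comp _
  right_triangle_components := by
    intro C
    ext a p
    refine Cat.ext (CategoryTheory.Functor.ext (fun g => ?_) (fun g g' h => ?_))
    · change (sliceFunctor p).obj ((Over.map g.hom).obj (Over.mk (𝟙 g.left))) =
        (sliceFunctor p).obj g
      congr 1
      exact obj_mk_id g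
    · exact evalMap_restrict (sliceFunctor p) h _

end Presheaves

/-! ### Presheaves of groupoids -/

section GroupoidPresheaves

section Auxiliary

variable {G H K L : Type*} [Category G] [Category H] [Category K] [Category L]

lemma aux_comp {x y z : G} (f : x ⟶ y) (h : y = z) (h' : z = y) :
    (f ≫ eqToHom h) ≫ eqToHom h' = f := by
  simp

lemma aux_map (F : G ⥤ H) {x y z : G} {t w : H} (f : x ⟶ y) (h : y = z) (h₁ : F.obj y = t)
    (h₂ : t = w) (h₃ : F.obj z = w) :
    (F.map f ≫ eqToHom h₁) ≫ eqToHom h₂ = F.map (f ≫ eqToHom h) ≫ eqToHom h₃ := by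
  simp [eqToHom_map]

lemma aux_id (F : G ⥤ H) {x : G} {y z : H} (h : F.obj x = y) (h' : y = z) (h'' : F.obj x = z) :
    (F.map (𝟙 x) ≫ eqToHom h) ≫ eqToHom h' = eqToHom h'' := by
  simp

lemma aux_map_comp (F : G ⥤ H) (T : H ⥤ H) (hT : T = 𝟭 H) {x y z : G} (k : x ⟶ y) (l : y ⟶ z)
    {t w : H} (h₁ : F.obj z = t) (h₂ : t = w) (h₃ : F.obj y = T.obj (F.obj y))
    (h₄ : F.obj z = T.obj (F.obj z)) (h₅ : T.obj (T.obj (F.obj z)) = w) :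
    (F.map (k ≫ l) ≫ eqToHom h₁) ≫ eqToHom h₂ =
      (F.map k ≫ eqToHom h₃) ≫ T.map (F.map l ≫ eqToHom h₄) ≫ eqToHom h₅ := by
  subst hT
  simp

lemma aux_nat (P : G ⥤ K) (Q : G ⥤ H) (R : H ⥤ K) (T : K ⥤ K) (hP : P = Q ⋙ R) (hT : T = 𝟭 K)
    {x y : G} (k : x ⟶ y) {q : H} {t w : K} {v : K}
    (h₁ : P.obj x = R.obj (Q.obj x)) (h₂ : Q.obj y = q) (h₃ : R.obj q = t) (h₄ : t = w)
    (h₅ : P.obj y = T.obj (P.obj y)) (h₆ : P.obj y = v) (h₇ : T.obj v = w) :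
    (eqToHom h₁ ≫ R.map (Q.map k ≫ eqToHom h₂) ≫ eqToHom h₃) ≫ eqToHom h₄ =
      (P.map k ≫ eqToHom h₅) ≫ T.map (eqToHom h₆) ≫ eqToHom h₇ := by
  subst hP hT
  simp [eqToHom_map]

lemma aux_eq (F : G ⥤ H) {x y : G} {z w v : H} (h₁ : x = y) (h₂ : F.obj y = z) (h₃ : z = w)
    (h₄ : F.obj x = v) (h₅ : v = w) :
    (F.map (eqToHom h₁) ≫ eqToHom h₂) ≫ eqToHom h₃ = eqToHom h₄ ≫ eqToHom h₅ := by
  subst h₁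
  simp

lemma aux_nat' (P : G ⥤ K) (Q : G ⥤ H) (R : H ⥤ K) (hP : P = Q ⋙ R) {x y : G} (k : x ⟶ y)
    {t w : K} (h₁ : R.obj (Q.obj y) = t) (h₂ : t = w) (h₃ : R.obj (Q.obj x) = P.obj x)
    (h₄ : P.obj y = w) :
    (R.map (Q.map k) ≫ eqToHom h₁) ≫ eqToHom h₂ =
      eqToHom h₃ ≫ P.map k ≫ eqToHom h₄ := by
  subst hP
  simp

lemma aux_square (P : G ⥤ H) (Q : H ⥤ L) (R : G ⥤ K) (S : K ⥤ L) (h : P ⋙ Q = R ⋙ S) {x y : G}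
    (k : x ⟶ y) {t w : L} (h₁ : S.obj (R.obj y) = t) (h₂ : t = w)
    (h₃ : S.obj (R.obj x) = Q.obj (P.obj x)) {q : H} (h₄ : P.obj y = q) (h₅ : Q.obj q = w) :
    (S.map (R.map k) ≫ eqToHom h₁) ≫ eqToHom h₂ =
      eqToHom h₃ ≫ Q.map (P.map k ≫ eqToHom h₄) ≫ eqToHom h₅ := by
  have := Functor.congr_hom h k
  simp only [Functor.comp_map] at this
  simp [eqToHom_map, this]

lemma natTrans_ext {P P' Q Q' : G ⥤ H} (α : P ⟶ Q) (β : P' ⟶ Q') (h : P = P') (h' : Q = Q')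
    (hg : ∀ g, α.app g = eqToHom (Functor.congr_obj h g) ≫ β.app g ≫
      eqToHom (Functor.congr_obj h' g).symm) :
    α = eqToHom h ≫ β ≫ eqToHom h'.symm := by
  ext g
  simp [hg, eqToHom_app]

lemma aux_T (T : G ⥤ G) (hT : T = 𝟭 G) {x y o s t : G} (k : x ⟶ y) (h₁ : T.obj y = T.obj o)
    (l : o ⟶ s) (h₂ : o = s) (hl : l = eqToHom h₂) (h₃ : T.obj s = t) (h₄ : t = y)
    (h₅ : T.obj x = x) :
    ((T.map k ≫ eqToHom h₁) ≫ T.map l ≫ eqToHom h₃) ≫ eqToHom h₄ = eqToHom h₅ ≫ k := by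
  subst hT hl
  simp

end Auxiliary

/-- The bifunctor sending small categories `D`, `C` to the groupoid whose objects are the functors
`C ⥤ D` and whose morphisms are the natural isomorphisms. -/
def homGrpd : Cat.{u, u} ⥤ (Cat.{u, u}ᵒᵖ ⥤ Grpd.{u, u}) where
  obj D :=
    { obj := fun C => Grpd.of (Core (C.unop ⥤ D))
      map := fun F => ((Functor.whiskeringLeft _ _ D).obj F.unop.toFunctor).core
      map_id := fun _ => rfl
      map_comp := fun _ _ => rfl }
  map G :=
    { app := fun C => ((Functor.whiskeringRight C.unop _ _).obj G.toFunctor).core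
      naturality := fun _ _ _ => rfl }
  map_id _ := rfl
  map_comp _ _ := rfl

variable {A : Type u} [SmallCategory A]

/-- The restriction functor `X(f) : X(b) ⥤ X(a)` of a presheaf of groupoids `X`. -/
def res (X : Aᵒᵖ ⥤ Grpd.{u, u}) {a b : A} (f : a ⟶ b) : X.obj (op b) ⥤ X.obj (op a) :=
  X.map f.op

lemma res_id (X : Aᵒᵖ ⥤ Grpd.{u, u}) (a : A) : res X (𝟙 a) = 𝟭 _ :=
  X.map_id (op a)

lemma res_comp (X : Aᵒᵖ ⥤ Grpd.{u, u}) {a b c : A} (f : a ⟶ b) (g : b ⟶ c) :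
    res X (f ≫ g) = res X g ⋙ res X f :=
  X.map_comp g.op f.op

/-- Objects of the category of elements of a presheaf of groupoids `X`: pairs `(a, x)` of an object
`a` of `A` and an object `x` of `X(a)`. -/
structure GrpdElements (X : Aᵒᵖ ⥤ Grpd.{u, u}) : Type u where
  base : A
  fiber : X.obj (op base)

namespace GrpdElements

/-- Morphisms `(a, x) ⟶ (a', x')` of the category of elements of `X`: pairs `(f, k)` of a morphism
`f : a ⟶ a'` of `A` and a morphism `k : x ⟶ X(f)(x')` of `X(a)`. -/
structure Hom {X : Aᵒᵖ ⥤ Grpd.{u, u}} (x y : GrpdElements X) : Type u where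
  base : x.base ⟶ y.base
  fiber : x.fiber ⟶ (res X base).obj y.fiber

variable {X : Aᵒᵖ ⥤ Grpd.{u, u}}

lemma Hom.ext' {x y : GrpdElements X} {f g : Hom x y} (h : f.base = g.base)
    (h' : f.fiber ≫ eqToHom (by rw [h]) = g.fiber) : f = g := by
  obtain ⟨f, k⟩ := f
  obtain ⟨g, l⟩ := g
  obtain rfl : f = g := h
  simp at h'
  rw [h']

/-- The composite of `(f, k)` and `(g, l)` is `(f ≫ g, k ≫ X(f)(l))`; the morphisms `eqToHom` are
identities, which express `X(𝟙) = 𝟭` and `X(f ≫ g) = X(f) ∘ X(g)`. -/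
instance : SmallCategory (GrpdElements X) where
  Hom := Hom
  id x := ⟨𝟙 x.base, eqToHom (by rw [res_id]; rfl)⟩
  comp {x y z} f g := ⟨f.base ≫ g.base,
    f.fiber ≫ (res X f.base).map g.fiber ≫ eqToHom (by rw [res_comp]; rfl)⟩
  id_comp {x y} f := by
    refine Hom.ext' (by simp) ?_
    have := Functor.congr_hom (res_id X x.base) f.fiber
    simp [this]
  comp_id {x y} f := by
    refine Hom.ext' (by simp) ?_
    simp [eqToHom_map]
  assoc {w x y z} f g h := by
    refine Hom.ext' (by simp) ?_
    have := Functor.congr_hom (res_comp X f.base g.base) h.fiber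
    simp [this, eqToHom_map]

@[simp] lemma id_base (x : GrpdElements X) : Hom.base (𝟙 x) = 𝟙 x.base := rfl
@[simp] lemma id_fiber (x : GrpdElements X) :
    Hom.fiber (𝟙 x) = eqToHom (by rw [id_base, res_id]; rfl) := rfl
@[simp] lemma comp_base {x y z : GrpdElements X} (f : x ⟶ y) (g : y ⟶ z) :
    Hom.base (f ≫ g) = Hom.base f ≫ Hom.base g := rfl
@[simp] lemma comp_fiber {x y z : GrpdElements X} (f : x ⟶ y) (g : y ⟶ z) :
    Hom.fiber (f ≫ g) = Hom.fiber f ≫ (res X (Hom.base f)).map (Hom.fiber g) ≫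
      eqToHom (by rw [comp_base, res_comp]; rfl) := rfl

lemma hom_ext {x y : GrpdElements X} {f g : x ⟶ y} (h : Hom.base f = Hom.base g)
    (h' : Hom.fiber f ≫ eqToHom (by rw [h]) = Hom.fiber g) : f = g := Hom.ext' h h'

end GrpdElements

/-- The component of a morphism of presheaves of groupoids at an object of `A`. -/
def appAt {X Y : Aᵒᵖ ⥤ Grpd.{u, u}} (α : X ⟶ Y) (a : A) : X.obj (op a) ⥤ Y.obj (op a) :=
  α.app (op a)

lemma res_comp_comp {X Y : Aᵒᵖ ⥤ Grpd.{u, u}} (α : X ⟶ Y) {a b : A} (f : a ⟶ b) :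
    res X f ⋙ appAt α a = appAt α b ⋙ res Y f :=
  α.naturality f.op

/-- The functor induced on categories of elements by a morphism of presheaves of groupoids. -/
def GrpdElements.map {X Y : Aᵒᵖ ⥤ Grpd.{u, u}} (α : X ⟶ Y) : GrpdElements X ⥤ GrpdElements Y where
  obj x := ⟨x.base, (appAt α x.base).obj x.fiber⟩
  map {x y} f := ⟨f.base, (appAt α x.base).map f.fiber ≫
    eqToHom (Functor.congr_obj (res_comp_comp α f.base) _)⟩
  map_id x := by
    refine hom_ext rfl ?_
    simp [eqToHom_map]
  map_comp {x y z} f g := by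
    refine hom_ext rfl ?_
    have := Functor.congr_hom (res_comp_comp α f.base) g.fiber
    simp at this
    simp [eqToHom_map, this]

namespace GrpdElements
variable {X : Aᵒᵖ ⥤ Grpd.{u, u}}

@[simp] lemma eqToHom_base {x y : GrpdElements X} (h : x = y) :
    Hom.base (eqToHom h) = eqToHom (congrArg base h) := by
  subst h; rfl

@[simp] lemma eqToHom_fiber {x y : GrpdElements X} (h : x = y) :
    Hom.fiber (eqToHom h) = eqToHom (by subst h; simp [res_id]) := by
  subst h; rfl

lemma eqToHom_comp_fiber {x y z : GrpdElements X} (h : x = y) (f : y ⟶ z)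
    (e : y.fiber = (res X f.base).obj z.fiber) (hf : f.fiber = eqToHom e) :
    ∃ e' : x.fiber = (res X (Hom.base (eqToHom h ≫ f))).obj z.fiber,
      Hom.fiber (eqToHom h ≫ f) = eqToHom e' := by
  subst h
  have : eqToHom rfl ≫ f = f := Category.id_comp f
  rw [this]
  exact ⟨e, hf⟩

lemma mk_hom_ext {b c : A} {x x' : X.obj (op b)} {y y' : X.obj (op c)} (hx : x = x') (hy : y = y')
    (f : GrpdElements.mk b x ⟶ GrpdElements.mk c y)
    (f' : GrpdElements.mk b x' ⟶ GrpdElements.mk c y') (h : f.base = f'.base)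
    (h' : f.fiber ≫ eqToHom (by rw [h, hy]) = eqToHom hx ≫ f'.fiber) :
    f = eqToHom (congrArg (GrpdElements.mk b) hx) ≫ f' ≫
      eqToHom (congrArg (GrpdElements.mk c) hy).symm := by
  subst hx hy
  simp only [eqToHom_refl, Category.id_comp, Category.comp_id] at h' ⊢
  exact hom_ext h h'

end GrpdElements
open GrpdElements

/-- The functor `I_A`, sending a presheaf of groupoids to its category of elements. -/
def IA (A : Type u) [SmallCategory A] : (Aᵒᵖ ⥤ Grpd.{u, u}) ⥤ Cat.{u, u} where
  obj X := Cat.of (GrpdElements X)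
  map α := (GrpdElements.map α).toCatHom
  map_id X := by
    refine Cat.ext (Functor.hext (fun _ => rfl) (fun x y f => heq_of_eq (hom_ext rfl ?_)))
    change (f.fiber ≫ eqToHom _) ≫ eqToHom _ = f.fiber
    exact aux_comp _ _ _
  map_comp {X Y Z} α β := by
    refine Cat.ext (Functor.hext (fun _ => rfl) (fun x y f => heq_of_eq (hom_ext rfl ?_)))
    exact aux_map (appAt β x.base) ((appAt α x.base).map f.fiber) _ _ _ _

/-- The functor `I_A^*`, sending `C` to the presheaf of groupoids `a ↦ Homi(A/a, C)` of functors and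
natural isomorphisms. -/
def IAStar (A : Type u) [SmallCategory A] : Cat.{u, u} ⥤ (Aᵒᵖ ⥤ Grpd.{u, u}) :=
  homGrpd ⋙ (Functor.whiskeringLeft _ _ _).obj (Over.mapFunctor A).op

lemma res_obj_eq (X : Aᵒᵖ ⥤ Grpd.{u, u}) {a : A} {g g' : Over a} (h : g ⟶ g')
    (x : X.obj (op a)) : (res X g.hom).obj x = (res X h.left).obj ((res X g'.hom).obj x) :=
  Functor.congr_obj ((congrArg (res X) (Over.w h).symm).trans (res_comp X h.left g'.hom)) x

/-- For `x` in `X(a)`, the functor `A/a ⥤ I_A X` sending `g : b ⟶ a` to `(b, X(g)(x))`. -/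
def IAUnitObj (X : Aᵒᵖ ⥤ Grpd.{u, u}) {a : A} (x : X.obj (op a)) : Over a ⥤ GrpdElements X where
  obj g := ⟨g.left, (res X g.hom).obj x⟩
  map {g g'} h := ⟨h.left, eqToHom (res_obj_eq X h x)⟩
  map_id g := hom_ext rfl (by simp)
  map_comp f g := hom_ext rfl (by simp [eqToHom_map])

lemma IAUnitObj_res (X : Aᵒᵖ ⥤ Grpd.{u, u}) {a a' : A} (f : a ⟶ a') (x : X.obj (op a')) :
    IAUnitObj X ((res X f).obj x) = Over.map f ⋙ IAUnitObj X x := by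
  have (g : Over a) : (res X g.hom).obj ((res X f).obj x) =
      (res X ((Over.map f).obj g).hom).obj x :=
    (Functor.congr_obj (res_comp X g.hom f) x).symm
  exact CategoryTheory.Functor.ext
    (fun g => congrArg (GrpdElements.mk (X := X) g.left) (this g))
    (fun g g' h => mk_hom_ext (this g) (this g') _ _ rfl
      ((eqToHom_trans (res_obj_eq X h ((res X f).obj x)) _).trans
        (eqToHom_trans (this g) (res_obj_eq X ((Over.map f).map h) x)).symm))

lemma IAUnitObj_map {X Y : Aᵒᵖ ⥤ Grpd.{u, u}} (α : X ⟶ Y) {a : A} (x : X.obj (op a)) :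
    IAUnitObj X x ⋙ GrpdElements.map α = IAUnitObj Y ((appAt α a).obj x) := by
  have (g : Over a) : (appAt α g.left).obj ((res X g.hom).obj x) =
      (res Y g.hom).obj ((appAt α a).obj x) :=
    Functor.congr_obj (res_comp_comp α g.hom) x
  exact CategoryTheory.Functor.ext
    (fun g => congrArg (GrpdElements.mk (X := Y) g.left) (this g))
    (fun g g' h => mk_hom_ext (this g) (this g') _ _ rfl (aux_eq _ (res_obj_eq X h x) _ _ (this g) (res_obj_eq Y h _)))

/-- The natural transformation induced by a morphism `k : x ⟶ y` of `X(a)`, with components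
`(𝟙, X(g)(k))`. -/
def IAUnitMap (X : Aᵒᵖ ⥤ Grpd.{u, u}) {a : A} {x y : X.obj (op a)} (k : x ⟶ y) :
    IAUnitObj X x ⟶ IAUnitObj X y where
  app g := ⟨𝟙 g.left, (res X g.hom).map k ≫
    eqToHom (Functor.congr_obj (res_id X g.left) _).symm⟩
  naturality g g' h := by
    refine hom_ext ((Category.comp_id _).trans (Category.id_comp _).symm) ?_
    exact aux_nat (res X g.hom) (res X g'.hom) (res X h.left) (res X (𝟙 g.left))
      ((congrArg (res X) (Over.w h).symm).trans (res_comp X h.left g'.hom)) (res_id X g.left) k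
      (res_obj_eq X h x) _ _ _ _ (res_obj_eq X h y) _

/-- The functor from `X(a)` to the groupoid of functors `A/a ⥤ I_A X`. -/
def IAUnitApp (X : Aᵒᵖ ⥤ Grpd.{u, u}) (a : A) :
    X.obj (op a) ⥤ Core (Over a ⥤ GrpdElements X) :=
  Core.functorToCore
    { obj := fun x => IAUnitObj X x
      map := fun k => IAUnitMap X k
      map_id := fun x => by
        ext g
        refine hom_ext rfl ?_
        exact aux_id (res X g.hom) _ _ (Functor.congr_obj (res_id X g.left) _).symm
      map_comp := fun {x y z} k l => by
        ext g
        refine hom_ext (Category.comp_id _).symm ?_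
        exact aux_map_comp (res X g.hom) (res X (𝟙 g.left)) (res_id X g.left) k l _ _ _ _ _ }

lemma core_eqToHom_hom {D : Type*} [Category D] {x y : Core D} (h : x = y) :
    (eqToHom h).iso.hom = eqToHom (congrArg Core.of h) := by
  subst h
  rfl

/-- The counit functor `I_A I_A^* C ⥤ C`, sending `(a, p)` to `p(𝟙 a)`. -/
def IACounitFunctor (C : Cat.{u, u}) : GrpdElements ((IAStar A).obj C) ⥤ C where
  obj z := Functor.obj (C := Over z.base) z.fiber.of (Over.mk (𝟙 _))
  map {z z'} f := evalMap (p := z.fiber.of) (p' := z'.fiber.of) f.base f.fiber.iso.hom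
  map_id z := by
    refine (congrArg (evalMap (𝟙 z.base)) ?_).trans
      (evalMap_id (p := z.fiber.of) (by rw [Over.mapId_eq]; rfl))
    exact core_eqToHom_hom (Functor.congr_obj (res_id ((IAStar A).obj C) z.base) _).symm
  map_comp {z z' z''} f g := by
    refine (congrArg (evalMap (p := z.fiber.of) (p' := z''.fiber.of) (f.base ≫ g.base)) ?_).trans
      (evalMap_comp _ _ _ _)
    refine congrArg (fun t => f.fiber.iso.hom ≫ (Over.map f.base).whiskerLeft g.fiber.iso.hom ≫ t) ?_
    exact core_eqToHom_hom _

lemma core_ext {D E : Type*} [Category D] [Groupoid E] {F G : E ⥤ Core D}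
    (h : F ⋙ Core.inclusion D = G ⋙ Core.inclusion D) : F = G := by
  refine functor_ext_of_faithful (Core.inclusion D) (fun x => ?_) h
  exact congrArg Core.mk (Functor.congr_obj h x)

lemma IAUnitApp_naturality (X : Aᵒᵖ ⥤ Grpd.{u, u}) {a a' : A} (f : a ⟶ a') :
    res X f ⋙ IAUnitApp X a =
      IAUnitApp X a' ⋙ res ((IAStar A).obj (Cat.of (GrpdElements X))) f := by
  refine core_ext (CategoryTheory.Functor.ext (fun x => ?_) (fun x y k => ?_))
  · exact IAUnitObj_res X f x
  · exact natTrans_ext _ _ (IAUnitObj_res X f x) (IAUnitObj_res X f y) (fun g => mk_hom_ext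
      (Functor.congr_obj (res_comp X g.hom f) x).symm
      (Functor.congr_obj (res_comp X g.hom f) y).symm _ _ rfl
      (aux_nat' _ _ _ (res_comp X g.hom f) k _ _ _ _))

lemma IAUnitApp_comp {X Y : Aᵒᵖ ⥤ Grpd.{u, u}} (α : X ⟶ Y) (a : A) :
    appAt α a ⋙ IAUnitApp Y a =
      IAUnitApp X a ⋙ appAt ((IAStar A).map ((IA A).map α)) a := by
  refine core_ext (CategoryTheory.Functor.ext (fun x => ?_) (fun x y k => ?_))
  · exact (IAUnitObj_map α x).symm
  · exact natTrans_ext _ _ (IAUnitObj_map α x).symm (IAUnitObj_map α y).symm (fun g => mk_hom_ext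
      (Functor.congr_obj (res_comp_comp α g.hom) x).symm
      (Functor.congr_obj (res_comp_comp α g.hom) y).symm _ _ rfl
      (aux_square _ _ _ _ (res_comp_comp α g.hom) k _ _ _ _ _))

lemma IACounit_IAUnit {C : Cat.{u, u}} {a : A} (p : Core (Over a ⥤ C)) :
    IAUnitObj ((IAStar A).obj C) p ⋙ IACounitFunctor C = p.of := by
  refine CategoryTheory.Functor.ext (fun g => congrArg p.of.obj (obj_mk_id g)) (fun g g' h => ?_)
  refine Eq.trans ?_ (evalMap_restrict p.of h (by
    rw [← Functor.assoc, ← Over.mapComp_eq, Over.w]))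
  exact congrArg (evalMap (p := Over.map g.hom ⋙ p.of) (p' := Over.map g'.hom ⋙ p.of) h.left)
    (core_eqToHom_hom (res_obj_eq ((IAStar A).obj C) h p))

lemma evalMap_unit (X : Aᵒᵖ ⥤ Grpd.{u, u}) {a a' : A} (f : a ⟶ a') {x : X.obj (op a)}
    {x' : X.obj (op a')} (k : x ⟶ (res X f).obj x')
    (h : IAUnitObj X ((res X f).obj x') = Over.map f ⋙ IAUnitObj X x') :
    evalMap f (IAUnitMap X k ≫ eqToHom h) =
      eqToHom (congrArg (GrpdElements.mk a) (Functor.congr_obj (res_id X a) x)) ≫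
        (⟨f, k⟩ : Hom (GrpdElements.mk a x) (GrpdElements.mk a' x')) ≫
        eqToHom (congrArg (GrpdElements.mk a') (Functor.congr_obj (res_id X a') x')).symm := by
  have e : evalMap f (IAUnitMap X k ≫ eqToHom h) = (IAUnitMap X k).app (Over.mk (𝟙 a)) ≫
      eqToHom (Functor.congr_obj h _) ≫ (IAUnitObj X x').map (toId f) := by
    simp [evalMap, eqToHom_app]
  rw [e]
  refine mk_hom_ext (Functor.congr_obj (res_id X a) x) (Functor.congr_obj (res_id X a') x')
    _ _ ?_ ?_
  · rw [comp_base, comp_base, eqToHom_base]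
    exact (Category.id_comp _).trans (Category.id_comp _)
  · obtain ⟨e', he'⟩ := eqToHom_comp_fiber (Functor.congr_obj h (Over.mk (𝟙 a)))
      ((IAUnitObj X x').map (toId f)) (res_obj_eq X (toId f) x') rfl
    exact aux_T (res X (𝟙 a)) (res_id X a) k _ _ e' he' _ _ _

lemma evalMap_whisker {A C : Type u} [SmallCategory A] [SmallCategory C] {a : A}
    {p p' : Over a ⥤ C} (k : p ⟶ p') (g : Over a)
    (h : Over.map g.hom ⋙ p' = Over.map (𝟙 g.left) ⋙ Over.map g.hom ⋙ p') :
    evalMap (p := Over.map g.hom ⋙ p) (𝟙 g.left) ((Over.map g.hom).whiskerLeft k ≫ eqToHom h) =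
      eqToHom (congrArg p.obj (obj_mk_id g)) ≫ k.app g ≫
        eqToHom (congrArg p'.obj (obj_mk_id g)).symm := by
  have (o : Over a) (e : o = g) : k.app o =
      eqToHom (congrArg p.obj e) ≫ k.app g ≫ eqToHom (congrArg p'.obj e).symm := by
    subst e; simp
  rw [evalMap, toId_id]
  simp [eqToHom_map, eqToHom_app, this _ (obj_mk_id g)]

/-- The adjunction between `I_A` and `I_A^*`. -/
def IAAdj (A : Type u) [SmallCategory A] : IA A ⊣ IAStar A where
  unit :=
    { app := fun X =>
        { app := fun a => IAUnitApp X a.unop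
          naturality := fun a a' f => IAUnitApp_naturality X f.unop }
      naturality := by
        intro X Y α
        ext a : 2
        exact IAUnitApp_comp α a.unop }
  counit :=
    { app := fun C => (IACounitFunctor C).toCatHom
      naturality := by
        intro C D F
        exact Cat.ext (Functor.hext (fun _ => rfl) (fun z z' f => heq_of_eq
          (map_evalMap' F.toFunctor f.base _ f.fiber.iso.hom (Category.comp_id _)))) }
  left_triangle_components := by
    intro X
    refine Cat.ext (CategoryTheory.Functor.ext
      (fun z => congrArg (GrpdElements.mk (X := X) z.base)
        (Functor.congr_obj (res_id X z.base) z.fiber))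
      (fun z z' f => Eq.trans ?_
        (evalMap_unit X f.base f.fiber (IAUnitObj_res X f.base z'.fiber))))
    refine congrArg (evalMap (p := IAUnitObj X z.fiber) (p' := IAUnitObj X z'.fiber) f.base) ?_
    exact congrArg (fun t => IAUnitMap X f.fiber ≫ t)
      (core_eqToHom_hom (Functor.congr_obj (IAUnitApp_naturality X f.base) z'.fiber))
  right_triangle_components := by
    intro C
    ext a : 2
    refine core_ext (CategoryTheory.Functor.ext
      (fun p => IACounit_IAUnit p) (fun p p' k => ?_))
    refine natTrans_ext _ _ (IACounit_IAUnit p) (IACounit_IAUnit p')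
      (fun g => Eq.trans ?_ (evalMap_whisker k.iso.hom g (by rw [Over.mapId_eq]; rfl)))
    refine congrArg (evalMap (p := Over.map g.hom ⋙ p.of) (p' := Over.map g.hom ⋙ p'.of)
      (𝟙 g.left)) ?_
    exact congrArg (fun t => (Over.map g.hom).whiskerLeft k.iso.hom ≫ t)
      (core_eqToHom_hom (Functor.congr_obj (res_id ((IAStar A).obj C) g.left) _).symm)

end GroupoidPresheaves

/-! ### Test categories and groupoidal test categories -/

section TestCategories

variable (W : MorphismProperty Cat.{u, u}) (A : Type u) [SmallCategory A]

/-- The `W`-equivalences of presheaves of sets: the morphisms sent into `W` by `i_A`. -/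
def presheafEquivalences : MorphismProperty (Aᵒᵖ ⥤ Type u) :=
  W.inverseImage (iA A)

/-- `A` is a `W`-weak test category. -/
def IsWeakTest : Prop :=
  IsHomotopicalEquivalence (presheafEquivalences W A) W (iAAdj A)

/-- `A` is a `W`-local test category. -/
def IsLocalTest : Prop :=
  ∀ a : A, IsWeakTest W (Over a)

/-- `A` is a `W`-test category. -/
structure IsTest : Prop where
  weakTest : IsWeakTest W A
  localTest : IsLocalTest W A

/-- `A` is a `W`-strict test category. -/
structure IsStrictTest : Prop where
  totallyAspherical : IsTotallyAspherical W A
  test : IsTest W A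

/-- The `W`-equivalences of presheaves of groupoids: the morphisms sent into `W` by `I_A`. -/
def grpdPresheafEquivalences : MorphismProperty (Aᵒᵖ ⥤ Grpd.{u, u}) :=
  W.inverseImage (IA A)

/-- `A` is a `W`-groupoidal weak test category. -/
def IsGroupoidalWeakTest : Prop :=
  IsHomotopicalEquivalence (grpdPresheafEquivalences W A) W (IAAdj A)

/-- `A` is a `W`-groupoidal local test category. -/
def IsGroupoidalLocalTest : Prop :=
  ∀ a : A, IsGroupoidalWeakTest W (Over a)

/-- `A` is a `W`-groupoidal test category. -/
structure IsGroupoidalTest : Prop where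
  groupoidalWeakTest : IsGroupoidalWeakTest W A
  groupoidalLocalTest : IsGroupoidalLocalTest W A

/-- `A` is a `W`-groupoidal strict test category. -/
structure IsGroupoidalStrictTest : Prop where
  totallyAspherical : IsTotallyAspherical W A
  groupoidalTest : IsGroupoidalTest W A

end TestCategories

end

end TestCat

/-! Both counits are instances of one construction. For a class `P` of morphisms of D, `SliceDiagram
A P` consists of pairs (a, p : A/a ⥤ D); its morphisms lie over morphisms f of A and carry a
transformation from p to the restriction of p' along f with components in `P`. If `P` is the class
of identities (`isos True`), this category is i_A i_A^* D; if `P` is the class of isomorphisms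
(`isos False`), it is I_A I_A^* D up to equivalence. In both cases the counit becomes `eval`, (a, p)
↦ p(𝟙 a). The left adjoint creates the weak equivalences of presheaves, so the weak test condition
says that every `eval` is in W (`isHomotopicalEquivalence_iff`). The slice of `eval` over c is again
a category of diagrams, with values in D/c. The condition therefore becomes: diagrams with values in
any category with a terminal object form an aspherical category (`eval_mem_iff`).

The link between the two theories is the interval {0 < 1}. The isomorphisms of a poset are
identities, so its two categories of diagrams coincide (`isos_partialOrder`). It also controls every
D with a terminal object: if the projection from interval diagrams to A is an aspherical functor, a
homotopy contracting D onto its terminal object shows that the projection from D-diagrams to A is in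
W (`proj_mem`). The slice of the projection over a is a category of diagrams on A/a, so the
hypothesis is `IsLocallyAspherical`, which does not depend on the choice of identities or
isomorphisms.

Since A/a has a terminal object, this condition characterizes local test categories of both kinds
(`isLocallyAspherical_iff`). Once it holds, both weak test conditions amount to the asphericity of A
(`IsLocallyAspherical.hasAsphericalDiagrams_iff`). This gives (a) and (b); in (c) the same condition
is added on both sides. -/

namespace TestCat

noncomputable section

/-! ### Basic localizers -/

namespace IsBasicLocalizer

variable {W : MorphismProperty Cat.{u, u}}
  {A B C : Type u} [SmallCategory A] [SmallCategory B] [SmallCategory C]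

lemma id_mem (hW : IsBasicLocalizer W) (A : Type u) [SmallCategory A] : W (𝟭 A).toCatHom :=
  hW.iso_mem (𝟙 (Cat.of A)) inferInstance

lemma comp_mem (hW : IsBasicLocalizer W) {F : A ⥤ B} {G : B ⥤ C} (hF : W F.toCatHom)
    (hG : W G.toCatHom) :
    W (F ⋙ G).toCatHom :=
  hW.twoOutOfThree.comp_mem F.toCatHom G.toCatHom hF hG

lemma of_comp_left (hW : IsBasicLocalizer W) {F : A ⥤ B} {G : B ⥤ C} (hF : W F.toCatHom)
    (hFG : W (F ⋙ G).toCatHom) :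
    W G.toCatHom :=
  hW.twoOutOfThree.of_precomp F.toCatHom G.toCatHom hF hFG

lemma of_comp_right (hW : IsBasicLocalizer W) {F : A ⥤ B} {G : B ⥤ C} (hG : W G.toCatHom)
    (hFG : W (F ⋙ G).toCatHom) :
    W F.toCatHom :=
  hW.twoOutOfThree.of_postcomp F.toCatHom G.toCatHom hG hFG

lemma isAspherical_iff (hW : IsBasicLocalizer W) {F : A ⥤ B} (hF : W F.toCatHom) :
    IsAspherical W A ↔ IsAspherical W B :=
  ⟨hW.of_comp_left (G := Functor.star B) hF, hW.comp_mem (G := Functor.star B) hF⟩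

lemma mem_of_isAspherical (hW : IsBasicLocalizer W) {F : A ⥤ B} (hA : IsAspherical W A)
    (hB : IsAspherical W B) :
    W F.toCatHom :=
  hW.of_comp_right (G := Functor.star B) hB hA

/-- Aspherical functors are weak equivalences. -/
lemma mem_of_isAsphericalFunctor (hW : IsBasicLocalizer W) {F : A ⥤ B}
    (hF : IsAsphericalFunctor W F) : W F.toCatHom :=
  hW.of_slices F (𝟭 B) fun b =>
    hW.mem_of_isAspherical (hF b)
      (hW.toPoint_mem (CostructuredArrow (𝟭 B) b) (inferInstanceAs (Limits.HasTerminal (Over b))))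

/-- The counit component at b is a terminal object of the slice A/b, so every slice is aspherical.
Equivalences of categories are the most frequent case below. -/
lemma mem_of_isLeftAdjoint (hW : IsBasicLocalizer W) (F : A ⥤ B) [F.IsLeftAdjoint] : W F.toCatHom :=
  hW.mem_of_isAsphericalFunctor fun b => hW.toPoint_mem _
    (mkTerminalOfRightAdjoint _ (Adjunction.ofIsLeftAdjoint F) b).hasTerminal

lemma isAspherical_congr (hW : IsBasicLocalizer W) (F : A ⥤ B) [F.IsLeftAdjoint] :
    IsAspherical W A ↔ IsAspherical W B :=
  hW.isAspherical_iff (hW.mem_of_isLeftAdjoint F)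

/-- The functor `B ⥤ Arrow B` sending an object to its identity. -/
def identityArrow (B : Type u) [SmallCategory B] : B ⥤ Arrow B where
  obj b := Arrow.mk (𝟙 b)
  map f := Arrow.homMk f f

/-- The codomain functor is left adjoint to the functor of identity arrows. -/
def rightFuncAdj (B : Type u) [SmallCategory B] :
    (Arrow.rightFunc : Arrow B ⥤ B) ⊣ identityArrow B :=
  Adjunction.mkOfHomEquiv
    { homEquiv := fun x b =>
        { toFun := fun f => Arrow.homMk (x.hom ≫ f) f (by simp [identityArrow])
          invFun := fun g => g.right
          left_inv := fun f => rfl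
          right_inv := fun g => by
            ext
            · have := Arrow.w g
              simpa [identityArrow] using this.symm
            · rfl }
      homEquiv_naturality_right := fun f g => by
        ext
        · exact (Category.assoc _ _ _).symm
        · rfl }

/-- A functor related to a weak equivalence by a natural transformation is a weak equivalence. -/
lemma mem_iff_of_natTrans (hW : IsBasicLocalizer W) {F G : A ⥤ B} (α : F ⟶ G) :
    W F.toCatHom ↔ W G.toCatHom := by
  -- The arrow category serves as a path object: `identityArrow B` is a common section of the domain
  -- and codomain functors. The codomain functor is a left adjoint, hence in W, and two-out-of-three
  -- gives the section and then the domain functor.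
  have hr : W (Arrow.rightFunc : Arrow B ⥤ B).toCatHom :=
    haveI := (rightFuncAdj B).isLeftAdjoint
    hW.mem_of_isLeftAdjoint _
  have hi : W (identityArrow B).toCatHom := hW.of_comp_right hr (hW.id_mem B)
  have hl : W (Arrow.leftFunc : Arrow B ⥤ B).toCatHom := hW.of_comp_left hi (hW.id_mem B)
  -- `α` seen as a functor to arrows: its composites with the domain and codomain functors are F and
  -- G.
  let H : A ⥤ Arrow B :=
    { obj := fun a => Arrow.mk (α.app a)
      map := fun f => Arrow.homMk (F.map f) (G.map f) }
  exact ⟨fun h => hW.comp_mem (F := H) (hW.of_comp_right (F := H) hl h) hr,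
    fun h => hW.comp_mem (F := H) (hW.of_comp_right (F := H) hr h) hl⟩

/-- If `r` is a retraction of `i` and `r ⋙ i` is a weak equivalence, then `r` is one. -/
lemma retraction_mem' (hW : IsBasicLocalizer W) {i : A ⥤ B} {r : B ⥤ A} (h : i ⋙ r = 𝟭 A)
    (h' : W (r ⋙ i).toCatHom) :
    W r.toCatHom :=
  hW.retraction_mem i.toCatHom r.toCatHom (congrArg Functor.toCatHom h) h'

end IsBasicLocalizer

/-- An adjunction whose weak equivalences on the source are created by the left adjoint is a
homotopical equivalence as soon as its counit is a weak equivalence. -/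
lemma isHomotopicalEquivalence_iff {C D : Type*} [Category C] [Category D]
    {W : MorphismProperty D} (hW : W.HasTwoOutOfThreeProperty)
    [W.ContainsIdentities] {L : C ⥤ D} {R : D ⥤ C} (adj : L ⊣ R) :
    IsHomotopicalEquivalence (W.inverseImage L) W adj ↔ ∀ X, W (adj.counit.app X) := by
  refine ⟨fun h => h.counit_mem, fun h => ⟨fun f hf => hf, fun {X Y} f hf => ?_, h, fun Y => ?_⟩⟩
  -- Naturality of the counit compares L(R(f)) with f; the unit is then handled by a triangle
  -- identity.
  · refine hW.of_postcomp (L.map (R.map f)) (adj.counit.app Y) (h Y) ?_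
    have := adj.counit.naturality f
    simp only [Functor.comp_map, Functor.id_map] at this
    rw [this]
    exact hW.comp_mem _ _ (h X) hf
  · refine hW.of_postcomp (L.map (adj.unit.app Y)) (adj.counit.app (L.obj Y)) (h _) ?_
    exact (adj.left_triangle_components Y).symm ▸ W.id_mem _

/-! ### Categories of diagrams on slices -/

section SliceIsomorphisms

variable {A : Type u} [SmallCategory A]

/-- The structural morphism `h ⟶ h ≫ 𝟙` of `A/a`. -/
def unitHom {a : A} (X : Over a) : X ⟶ (Over.map (𝟙 a)).obj X :=
  Over.homMk (𝟙 _)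

/-- The structural morphism `(h ≫ f) ≫ g ⟶ h ≫ (f ≫ g)` of `A/c`. -/
def assocHom {a b c : A} (f : a ⟶ b) (g : b ⟶ c) (X : Over a) :
    (Over.map g).obj ((Over.map f).obj X) ⟶ (Over.map (f ≫ g)).obj X :=
  Over.homMk (𝟙 _)

/-- The structural morphism `h ≫ f ⟶ h ≫ g` of `A/b` given by an equality `f = g`. -/
def congrHom {a b : A} {f g : a ⟶ b} (h : f = g) (X : Over a) :
    (Over.map f).obj X ⟶ (Over.map g).obj X :=
  Over.homMk (𝟙 _) (by simp [h])

@[simp] lemma congrHom_left {a b : A} {f g : a ⟶ b} (h : f = g) (X : Over a) :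
    (congrHom h X).left = 𝟙 _ := rfl

@[simp] lemma unitHom_left {a : A} (X : Over a) : (unitHom X).left = 𝟙 _ := rfl

@[simp] lemma assocHom_left {a b c : A} (f : a ⟶ b) (g : b ⟶ c) (X : Over a) :
    (assocHom f g X).left = 𝟙 _ := rfl

/-- The structural morphisms of slices are identities up to propositional equality of their ends, so
a diagram sends them into any class containing identities. -/
lemma unitHom_eq {a : A} (X : Over a) :
    unitHom X = eqToHom (by rw [Over.mapId_eq]; rfl) := by
  ext
  simp [Over.eqToHom_left]

lemma assocHom_eq {a b c : A} (f : a ⟶ b) (g : b ⟶ c) (X : Over a) :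
    assocHom f g X = eqToHom (by rw [Over.mapComp_eq]; rfl) := by
  ext
  simp [Over.eqToHom_left]

end SliceIsomorphisms

/-- The class of isomorphisms, or of identities (up to propositional equality of the source and
the target) if `s` holds. -/
def isos (s : Prop) (D : Type*) [Category D] : MorphismProperty D :=
  fun X Y f => IsIso f ∧ (s → ∃ h : X = Y, f = eqToHom h)

lemma eqToHom_mem {D : Type*} [Category D] (P : MorphismProperty D) [P.ContainsIdentities]
    {X Y : D} (h : X = Y) : P (eqToHom h) := by
  subst h
  exact P.id_mem X

section

variable {s : Prop} {C D : Type*} [Category C] [Category D]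

instance : (isos s D).IsMultiplicative where
  id_mem X := ⟨inferInstance, fun _ => ⟨rfl, rfl⟩⟩
  comp_mem := by
    rintro X Y Z f g ⟨_, hf⟩ ⟨_, hg⟩
    refine ⟨inferInstance, fun hs => ?_⟩
    obtain ⟨rfl, rfl⟩ := hf hs
    obtain ⟨rfl, rfl⟩ := hg hs
    exact ⟨rfl, by simp⟩

lemma isos_map (F : C ⥤ D) : isos s C ≤ (isos s D).inverseImage F := by
  rintro X Y f ⟨_, hf⟩
  refine ⟨inferInstanceAs (IsIso (F.map f)), fun hs => ?_⟩
  obtain ⟨rfl, rfl⟩ := hf hs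
  exact ⟨rfl, by simp⟩

lemma isos_prod {X Y : C × D} (f : X ⟶ Y) (h : isos s C f.1) (h' : isos s D f.2) :
    isos s (C × D) f := by
  obtain ⟨X, X'⟩ := X
  obtain ⟨Y, Y'⟩ := Y
  refine ⟨(isIso_prod_iff (f := f)).mpr ⟨h.1, h'.1⟩, fun hs => ?_⟩
  obtain ⟨f, f'⟩ := f
  obtain ⟨e, he⟩ := h.2 hs
  obtain ⟨e', he'⟩ := h'.2 hs
  dsimp at e he e' he'
  subst e e' he he'
  exact ⟨rfl, rfl⟩

/-- For identities: if the underlying morphism is an identity, the triangle over c forces the two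
structural morphisms to be equal. This identifies the class appearing on the slices of the
evaluation. -/
lemma isos_over (c : C) : isos s (Over c) = (isos s C).inverseImage (Over.forget c) := by
  refine le_antisymm (isos_map _) ?_
  rintro X Y f ⟨_, h⟩
  refine ⟨isIso_of_reflects_iso f (Over.forget c), fun hs => ?_⟩
  have key {x y : C} (e : x = y) {p : x ⟶ c} {q : y ⟶ c} (f : Over.mk p ⟶ Over.mk q)
      (he : f.left = eqToHom e) : ∃ h : Over.mk p = Over.mk q, f = eqToHom h := by
    subst e
    obtain rfl : q = p := by
      have := Over.w f
      rw [he] at this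
      simpa using this
    refine ⟨rfl, ?_⟩
    ext
    simpa using he
  obtain ⟨e, he⟩ := h hs
  exact key e f he

/-- By antisymmetry, isomorphic elements of a poset are equal. This is the point where the
set-valued and the groupoid-valued theories meet. -/
lemma isos_partialOrder {s' : Prop} (I : Type*) [PartialOrder I] : isos s I = isos s' I := by
  have (s s' : Prop) : isos s I ≤ isos s' I := by
    rintro X Y f ⟨_, _⟩
    refine ⟨inferInstance, fun _ => ⟨le_antisymm (leOfHom f) (leOfHom (inv f)), ?_⟩⟩
    exact Subsingleton.elim _ _
  exact le_antisymm (this _ _) (this _ _)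

end

/-- Objects of the category of diagrams on slices: pairs `(a, p)` of an object `a` of `A` and a
functor `p : A/a ⥤ D`. -/
structure SliceDiagram (A : Type u) [SmallCategory A] {D : Type u} [SmallCategory D]
    (P : MorphismProperty D) : Type u where
  base : A
  diag : Over base ⥤ D

namespace SliceDiagram

section

variable {A : Type u} [SmallCategory A] {D : Type u} [SmallCategory D] {P : MorphismProperty D}

/-- Morphisms `(a, p) ⟶ (a', p')` of diagrams on slices: a morphism `f : a ⟶ a'` and a natural
transformation from `p` to the restriction of `p'` along `f`, with components in `P`. -/
structure Hom (x y : SliceDiagram A P) : Type u where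
  base : x.base ⟶ y.base
  trans : x.diag ⟶ Over.map base ⋙ y.diag
  prop (g : Over x.base) : P (trans.app g)

/-- Components are compared after applying the target diagram to `congrHom`. This image can be
merged with other values of the diagram by functoriality, so identities between morphisms reduce to
identities in slices of A. -/
lemma Hom.ext' {x y : SliceDiagram A P} {f g : Hom x y} (h : f.base = g.base)
    (h' : ∀ X, f.trans.app X ≫ y.diag.map (congrHom h X) = g.trans.app X) :
    f = g := by
  obtain ⟨f, σ, hσ⟩ := f
  obtain ⟨g, τ, hτ⟩ := g
  obtain rfl : f = g := h
  congr
  ext X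
  rw [← h']
  exact ((congrArg (_ ≫ ·) (y.diag.map_id _)).trans (Category.comp_id _)).symm

lemma trans_app_congr {x y : SliceDiagram A P} {f g : Hom x y} (h : f = g) (X : Over x.base) :
    f.trans.app X ≫ y.diag.map (congrHom (congrArg Hom.base h) X) = g.trans.app X := by
  subst h
  exact (congrArg (_ ≫ ·) (y.diag.map_id _)).trans (Category.comp_id _)

variable [P.IsMultiplicative]

/-- Restriction of diagrams is only propositionally functorial in A. The identity and composite
transformations are corrected by the images of `unitHom` and `assocHom`, which stay in `P` because
they are identities up to equality of ends. -/
instance : SmallCategory (SliceDiagram A P) where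
  Hom := Hom
  id x :=
    { base := 𝟙 x.base
      trans :=
        { app := fun X => x.diag.map (unitHom X)
          naturality := fun X Y u => by
            dsimp
            rw [← Functor.map_comp, ← Functor.map_comp]
            congr 1
            ext
            simp }
      prop := fun X => by
        change P (x.diag.map (unitHom X))
        rw [unitHom_eq, eqToHom_map]
        exact eqToHom_mem P _ }
  comp {x y z} f g :=
    { base := f.base ≫ g.base
      trans :=
        { app := fun X => f.trans.app X ≫ g.trans.app ((Over.map f.base).obj X) ≫
            z.diag.map (assocHom f.base g.base X)
          naturality := fun X Y u => by
            have h1 := g.trans.naturality ((Over.map f.base).map u)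
            dsimp at h1 ⊢
            simp only [f.trans.naturality_assoc, Category.assoc, Functor.comp_map,
              reassoc_of% h1]
            rw [← Functor.map_comp, ← Functor.map_comp]
            congr 3
            ext
            simp }
      prop := fun X => P.comp_mem _ _ (f.prop X) (P.comp_mem _ _ (g.prop _) (by
        rw [assocHom_eq, eqToHom_map]
        exact eqToHom_mem P _)) }
  id_comp {x y} f := by
    refine Hom.ext' (Category.id_comp _) fun X => ?_
    have := f.trans.naturality (unitHom X)
    dsimp at this ⊢
    simp only [Category.assoc, reassoc_of% this]
    rw [← Functor.map_comp, ← Functor.map_comp]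
    convert Category.comp_id _
    convert y.diag.map_id _
    ext
    simp
  comp_id {x y} f := by
    refine Hom.ext' (Category.comp_id _) fun X => ?_
    dsimp
    simp only [Category.assoc]
    rw [← Functor.map_comp, ← Functor.map_comp]
    convert Category.comp_id _
    convert y.diag.map_id _
    ext
    simp
  assoc {w x y z} f g h := by
    refine Hom.ext' (Category.assoc _ _ _) fun X => ?_
    have := h.trans.naturality (assocHom f.base g.base X)
    dsimp at this ⊢
    simp only [Category.assoc, reassoc_of% this]
    rw [← Functor.map_comp, ← Functor.map_comp, ← Functor.map_comp]
    congr 4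
    ext
    simp

@[simp] lemma id_base (x : SliceDiagram A P) : Hom.base (𝟙 x) = 𝟙 x.base := rfl

@[simp] lemma id_trans_app (x : SliceDiagram A P) (X : Over x.base) :
    (Hom.trans (𝟙 x)).app X = x.diag.map (unitHom X) := rfl

@[simp] lemma comp_base {x y z : SliceDiagram A P} (f : x ⟶ y) (g : y ⟶ z) :
    Hom.base (f ≫ g) = f.base ≫ g.base := rfl

@[simp] lemma comp_trans_app {x y z : SliceDiagram A P} (f : x ⟶ y) (g : y ⟶ z)
    (X : Over x.base) : (Hom.trans (f ≫ g)).app X = f.trans.app X ≫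
      g.trans.app ((Over.map f.base).obj X) ≫ z.diag.map (assocHom f.base g.base X) := rfl

lemma hom_ext {x y : SliceDiagram A P} {f g : x ⟶ y} (h : f.base = g.base)
    (h' : ∀ X, f.trans.app X ≫ y.diag.map (congrHom h X) = g.trans.app X) :
    f = g := Hom.ext' h h'

/-- The projection to `A`. -/
@[simps]
def proj (A : Type u) [SmallCategory A] {D : Type u} [SmallCategory D] (P : MorphismProperty D)
    [P.IsMultiplicative] : SliceDiagram A P ⥤ A where
  obj x := x.base
  map f := f.base

/-- The evaluation `(a, p) ↦ p(𝟙 a)`. -/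
@[simps]
def eval (A : Type u) [SmallCategory A] {D : Type u} [SmallCategory D] (P : MorphismProperty D)
    [P.IsMultiplicative] : SliceDiagram A P ⥤ D where
  obj x := x.diag.obj (Over.mk (𝟙 _))
  map f := evalMap f.base f.trans
  map_id x := by
    simp only [evalMap, id_trans_app, id_base, ← Functor.map_comp]
    convert x.diag.map_id _
    ext
    simp [toId]
  map_comp {x y z} f g := by
    have := g.trans.naturality (toId f.base)
    dsimp at this
    simp only [evalMap, comp_trans_app, comp_base, Category.assoc, ← Functor.map_comp,
      reassoc_of% this]
    congr 3
    ext
    simp [toId]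

end

end SliceDiagram

/-! ### Slices of the projection and of the evaluation -/

namespace SliceDiagram

section

variable {A : Type u} [SmallCategory A] {D : Type u} [SmallCategory D] {P : MorphismProperty D}

/-- The functor from `A/b` to the iterated slice `(A/a)/h`, for `h : b ⟶ a`. -/
abbrev toIterated {a b : A} (h : b ⟶ a) : Over b ⥤ Over (Over.mk h) :=
  Over.iteratedSliceBackward (Over.mk h)

/-- The functor from the iterated slice `(A/a)/h` to `A/b`, for `h : b ⟶ a`. -/
abbrev ofIterated {a b : A} (h : b ⟶ a) : Over (Over.mk h) ⥤ Over b :=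
  Over.iteratedSliceForward (Over.mk h)

/-- The comparison morphism between an object of an iterated slice and its image under the
round trip. -/
def iteratedHom {a b : A} (h : b ⟶ a) (X : Over (Over.mk h)) :
    X ⟶ (toIterated h).obj ((ofIterated h).obj X) :=
  Over.homMk (Over.homMk (𝟙 _) ((Category.id_comp _).trans (Over.w X.hom)))
    (by ext; exact Category.id_comp _)

variable [P.IsMultiplicative]

variable (P) in
/-- The comparison functor between the slices of the projection to `A` and the category of diagrams
on slices of `A/a`. -/
def sliceProj (a : A) : CostructuredArrow (proj A P) a ⥤ SliceDiagram (Over a) P where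
  obj y := ⟨Over.mk y.hom, ofIterated y.hom ⋙ y.left.diag⟩
  map {y _} f :=
    { base := Over.homMk f.left.base (CostructuredArrow.w f)
      trans :=
        { app := fun X => f.left.trans.app ((ofIterated y.hom).obj X)
          naturality := fun _ _ u => f.left.trans.naturality ((ofIterated y.hom).map u) }
      prop := fun _ => f.left.prop _ }
  map_id y := hom_ext rfl fun _ => (congrArg (_ ≫ ·) (y.left.diag.map_id _)).trans
    (Category.comp_id _)
  map_comp {_ _ z} _ _ := hom_ext rfl fun _ => (congrArg (_ ≫ ·) (z.left.diag.map_id _)).trans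
    (Category.comp_id _)

/-- The comparison functor between slices of the projection and diagrams on slices of `A/a` is
fully faithful. -/
def fullyFaithfulSliceProj (a : A) : (sliceProj P a).FullyFaithful where
  preimage {y z} f := CostructuredArrow.homMk
    { base := f.base.left
      trans :=
        { app := fun X => f.trans.app ((toIterated y.hom).obj X)
          naturality := fun X Y u => f.trans.naturality ((toIterated y.hom).map u) }
      prop := fun X => f.prop _ } (Over.w f.base)
  map_preimage {y z} f := by
    refine hom_ext rfl fun X => (congrArg (_ ≫ ·) (z.left.diag.map_id _)).trans
      ((Category.comp_id _).trans ?_)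
    have := f.trans.naturality (iteratedHom y.hom X)
    exact ((congrArg (· ≫ _) (y.left.diag.map_id _)).trans (Category.id_comp _)).symm.trans
      (this.trans ((congrArg (_ ≫ ·) (z.left.diag.map_id _)).trans (Category.comp_id _)))
  preimage_map {y z} f := CostructuredArrow.hom_ext _ _ (hom_ext rfl fun X =>
    (congrArg (_ ≫ ·) (z.left.diag.map_id _)).trans (Category.comp_id _))

lemma over_mk_congr {a x : A} {X : Over a} {k k' : x ⟶ a} (e : k = k') (u : Over.mk k ⟶ X)
    (u' : Over.mk k' ⟶ X) (h : u.left = u'.left) : Over.mk u = Over.mk u' := by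
  subst e
  congr
  ext
  exact h

/-- An equality of functors, not merely an isomorphism, is needed: `P` is only known to contain
identities, so only equal diagrams are certain to be isomorphic in `SliceDiagram`. -/
lemma ofIterated_comp_toIterated {a b : A} (h : b ⟶ a) : ofIterated h ⋙ toIterated h = 𝟭 _ := by
  refine functor_ext_of_faithful (Over.forget _ ⋙ Over.forget _) (fun X => ?_) rfl
  exact over_mk_congr (Over.w X.hom) _ X.hom rfl

instance (a : A) : (sliceProj P a).EssSurj where
  mem_essImage x := by
    refine ⟨CostructuredArrow.mk (S := proj A P)
      (Y := (⟨x.base.left, toIterated x.base.hom ⋙ x.diag⟩ : SliceDiagram A P)) x.base.hom,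
      ⟨eqToIso ?_⟩⟩
    exact congrArg (fun F => SliceDiagram.mk x.base (F ⋙ x.diag))
      (ofIterated_comp_toIterated x.base.hom)

instance (a : A) : (sliceProj P a).IsEquivalence where
  faithful := (fullyFaithfulSliceProj a).faithful
  full := (fullyFaithfulSliceProj a).full

/-- The morphism to the terminal object of a slice. -/
def toMkId {a : A} (X : Over a) : X ⟶ Over.mk (𝟙 a) :=
  Over.homMk X.hom

@[simp] lemma toMkId_left {a : A} (X : Over a) : (toMkId X).left = X.hom := rfl

lemma comp_toMkId {a : A} {X Y : Over a} (u : X ⟶ Y) : u ≫ toMkId Y = toMkId X := by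
  ext
  simp

lemma toMkId_mk_id (a : A) : toMkId (Over.mk (𝟙 a)) = 𝟙 _ := rfl

lemma toMkId_map_mk_id {a b : A} (f : a ⟶ b) :
    toMkId ((Over.map f).obj (Over.mk (𝟙 a))) = toId f := by
  ext
  simp [toId]

lemma map_toMkId_toId {a b : A} (f : a ⟶ b) (X : Over a) :
    (Over.map f).map (toMkId X) ≫ toId f = toMkId ((Over.map f).obj X) := by
  ext
  simp [toId]

/-- The structural morphism of an object of a slice of the evaluation functor. -/
def augmentation {c : D} (y : CostructuredArrow (eval A P) c) :
    y.left.diag.obj (Over.mk (𝟙 _)) ⟶ c := y.hom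

lemma evalMap_augmentation {c : D} {y z : CostructuredArrow (eval A P) c} (f : y ⟶ z) :
    evalMap f.left.base f.left.trans ≫ augmentation z = augmentation y :=
  CostructuredArrow.w f

/-- The comparison functor between the slices of the evaluation functor and the category of
diagrams with values in the slices of `D`. -/
def sliceEval (P : MorphismProperty D) [P.IsMultiplicative] (c : D)
    [(P.inverseImage (Over.forget c)).IsMultiplicative] :
    CostructuredArrow (eval A P) c ⥤ SliceDiagram A (P.inverseImage (Over.forget c)) where
  obj y := ⟨y.left.base,
    -- Since 𝟙 a is terminal in A/a, a morphism p(𝟙 a) ⟶ c is the same as a cocone from p to c, that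
    -- is, a lift of p to D/c.
    { obj := fun X => Over.mk (y.left.diag.map (toMkId X) ≫ augmentation y)
      map := fun {X Y} u => Over.homMk (y.left.diag.map u) (by
        dsimp
        rw [← Functor.map_comp_assoc, comp_toMkId]) }⟩
  map {y z} f :=
    { base := f.left.base
      trans :=
        { app := fun X => Over.homMk (f.left.trans.app X) (by
            have h1 := f.left.trans.naturality (toMkId X)
            have h2 := evalMap_augmentation f
            dsimp at h1 h2 ⊢
            rw [← h2, ← map_toMkId_toId, Functor.map_comp]
            simp only [evalMap, Category.assoc, reassoc_of% h1])
          naturality := fun X Y u => by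
            ext
            exact f.left.trans.naturality u }
      prop := fun X => f.left.prop X }
  map_id y := hom_ext rfl fun X => by
    ext
    exact (congrArg (_ ≫ ·) (y.left.diag.map_id _)).trans (Category.comp_id _)
  map_comp {x y z} f g := hom_ext rfl fun X => by
    ext
    exact (congrArg (_ ≫ ·) (z.left.diag.map_id _)).trans (Category.comp_id _)

/-- The comparison functor between the slices of the evaluation functor and the category of
diagrams with values in the slices of `D` is fully faithful. -/
def fullyFaithfulSliceEval (c : D) [(P.inverseImage (Over.forget c)).IsMultiplicative] :
    (sliceEval (A := A) P c).FullyFaithful where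
  preimage {y z} f := CostructuredArrow.homMk
    { base := f.base
      trans :=
        { app := fun X => (f.trans.app X).left
          naturality := fun X Y u => congrArg (fun k => k.left) (f.trans.naturality u) }
      prop := fun X => f.prop X } (by
        let g : y.left.base ⟶ z.left.base := f.base
        have h : (f.trans.app (Over.mk (𝟙 _))).left ≫
          z.left.diag.map (toMkId ((Over.map g).obj (Over.mk (𝟙 _)))) ≫ augmentation z =
            y.left.diag.map (toMkId (Over.mk (𝟙 _))) ≫ augmentation y :=
          Over.w (f.trans.app (Over.mk (𝟙 _)))
        rw [toMkId_map_mk_id, toMkId_mk_id, CategoryTheory.Functor.map_id, Category.id_comp] at h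
        exact (Category.assoc _ _ _).trans h)
  map_preimage {y z} f := by
    refine hom_ext rfl fun X => ?_
    ext
    exact (congrArg (_ ≫ ·) (z.left.diag.map_id _)).trans (Category.comp_id _)
  preimage_map {y z} f := CostructuredArrow.hom_ext _ _ (hom_ext rfl fun X =>
    (congrArg (_ ≫ ·) (z.left.diag.map_id _)).trans (Category.comp_id _))

/-- A diagram in D/c is recovered from its underlying diagram in D and its structural morphism at 𝟙
a, because every other structural morphism factors through that one. -/
instance (c : D) [(P.inverseImage (Over.forget c)).IsMultiplicative] :
    (sliceEval (A := A) P c).EssSurj where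
  mem_essImage x := by
    refine ⟨CostructuredArrow.mk (S := eval A P)
      (Y := (⟨x.base, x.diag ⋙ Over.forget c⟩ : SliceDiagram A P)) (x.diag.obj (Over.mk (𝟙 _))).hom,
      ⟨eqToIso ?_⟩⟩
    refine congrArg (SliceDiagram.mk x.base)
      (functor_ext_of_faithful (Over.forget c) (fun X => ?_) rfl)
    exact congrArg Over.mk (Over.w (x.diag.map (toMkId X)))

instance (c : D) [(P.inverseImage (Over.forget c)).IsMultiplicative] :
    (sliceEval (A := A) P c).IsEquivalence where
  faithful := (fullyFaithfulSliceEval c).faithful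
  full := (fullyFaithfulSliceEval c).full

end
end SliceDiagram

/-! ### Functoriality in the values of the diagrams -/

section

namespace SliceDiagram

variable {A : Type u} [SmallCategory A] {D D' : Type u} [SmallCategory D] [SmallCategory D']
  {P : MorphismProperty D} [P.IsMultiplicative] {P' : MorphismProperty D'} [P'.IsMultiplicative]

variable (A) in
/-- Postcomposition of diagrams on slices with a functor. -/
@[simps]
def postcomp (F : D ⥤ D') (hF : P ≤ P'.inverseImage F) :
    SliceDiagram A P ⥤ SliceDiagram A P' where
  obj x := ⟨x.base, x.diag ⋙ F⟩
  map {x y} f :=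
    { base := f.base
      trans :=
        { app := fun X => F.map (f.trans.app X)
          naturality := fun X Y u => by
            have := f.trans.naturality u
            dsimp at this ⊢
            rw [← F.map_comp, this, F.map_comp] }
      prop := fun X => hF _ (f.prop X) }
  map_id x := hom_ext rfl fun X => (congrArg (_ ≫ ·) (CategoryTheory.Functor.map_id _ _)).trans
    (Category.comp_id _)
  map_comp {x y z} f g := hom_ext rfl fun X => by
    refine (congrArg (_ ≫ ·) (CategoryTheory.Functor.map_id _ _)).trans
      ((Category.comp_id _).trans ?_)
    dsimp
    rw [F.map_comp, F.map_comp]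

/-- A morphism of diagrams on slices over an identity. -/
@[simps]
def homOfNatTrans {a : A} {p q : Over a ⥤ D} (σ : p ⟶ q) (hσ : ∀ X, P (σ.app X)) :
    (⟨a, p⟩ : SliceDiagram A P) ⟶ ⟨a, q⟩ where
  base := 𝟙 a
  trans :=
    { app := fun X => σ.app X ≫ q.map (unitHom X)
      naturality := fun X Y u => by
        dsimp
        simp only [Category.assoc, σ.naturality_assoc, ← Functor.map_comp]
        congr 2
        ext
        simp }
  prop X := P.comp_mem _ _ (hσ X) (by
    rw [unitHom_eq, eqToHom_map]
    exact eqToHom_mem P _)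

/-- A morphism of diagrams on slices with prescribed components. -/
abbrev homMk {a b : A} {p : Over a ⥤ D} {q : Over b ⥤ D} (g : a ⟶ b) (φ : p ⟶ Over.map g ⋙ q)
    (hφ : ∀ X, P (φ.app X)) : (⟨a, p⟩ : SliceDiagram A P) ⟶ ⟨b, q⟩ :=
  { base := g, trans := φ, prop := hφ }

lemma comp_square {x₁ x₂ x₃ x₄ x₅ x₆ x₇ x₈ x₉ : D} {φ : x₁ ⟶ x₂} {τ : x₂ ⟶ x₃} {σ : x₁ ⟶ x₄}
    {ψ : x₄ ⟶ x₃} {u₁ : x₃ ⟶ x₅} {u₂ : x₅ ⟶ x₆} {u₃ : x₆ ⟶ x₇} {v₁ : x₄ ⟶ x₈} {ψ' : x₈ ⟶ x₉}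
    {v₂ : x₉ ⟶ x₇} {v₃ : x₃ ⟶ x₉} (h : φ ≫ τ = σ ≫ ψ) (h' : v₁ ≫ ψ' = ψ ≫ v₃)
    (h'' : u₁ ≫ u₂ ≫ u₃ = v₃ ≫ v₂) :
    (φ ≫ (τ ≫ u₁) ≫ u₂) ≫ u₃ = (σ ≫ v₁) ≫ ψ' ≫ v₂ := by
  simp only [Category.assoc, reassoc_of% h, reassoc_of% h', h'']

lemma map_comp_eq (F : D ⥤ D') {x₁ x₂ x₃ x₄ x₅ : D} {f₁ : x₁ ⟶ x₂} {f₂ : x₂ ⟶ x₃} {f₃ : x₃ ⟶ x₄}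
    {g₁ : x₁ ⟶ x₅} {g₂ : x₅ ⟶ x₄} (h : f₁ ≫ f₂ ≫ f₃ = g₁ ≫ g₂) :
    F.map f₁ ≫ F.map f₂ ≫ F.map f₃ = F.map g₁ ≫ F.map g₂ := by
  rw [← Functor.map_comp, ← Functor.map_comp, ← Functor.map_comp, h]

/-- Reduces naturality of transformations between functors into `SliceDiagram` to commutative
squares in D, absorbing the structural morphisms once and for all. -/
lemma homOfNatTrans_naturality {a b : A} {p p' : Over a ⥤ D} {q q' : Over b ⥤ D} (g : a ⟶ b)
    {φ : p ⟶ Over.map g ⋙ q} {hφ : ∀ X, P (φ.app X)} {ψ : p' ⟶ Over.map g ⋙ q'}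
    {hψ : ∀ X, P (ψ.app X)} {σ : p ⟶ p'} {hσ : ∀ X, P (σ.app X)} {τ : q ⟶ q'}
    {hτ : ∀ X, P (τ.app X)}
    (h : ∀ X, φ.app X ≫ τ.app ((Over.map g).obj X) = σ.app X ≫ ψ.app X) :
    homMk g φ hφ ≫ homOfNatTrans τ hτ = homOfNatTrans σ hσ ≫ homMk g ψ hψ := by
  refine hom_ext ((Category.comp_id _).trans (Category.id_comp _).symm) fun X => ?_
  refine comp_square (h X) (ψ.naturality (unitHom X)) ?_
  refine map_comp_eq q' (Over.OverMorphism.ext ?_)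
  exact (Category.id_comp _).trans rfl

variable (A P) in
/-- The section of the projection to `A` given by constant diagrams. -/
@[simps]
def constant (d : D) : A ⥤ SliceDiagram A P where
  obj a := ⟨a, (Functor.const _).obj d⟩
  map f :=
    { base := f
      trans := { app := fun X => 𝟙 d }
      prop := fun X => P.id_mem d }
  map_id a := rfl
  map_comp f g := hom_ext rfl fun X => by simp

lemma constant_comp_proj (d : D) : constant A P d ⋙ proj A P = 𝟭 A := rfl

/-- The comparison of constant diagrams with postcomposition with a constant functor. -/
def postcompConst (d : D') (F : D ⥤ D') (hF : P ≤ P'.inverseImage F)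
    (σ : F ⟶ (Functor.const _).obj d) (hσ : ∀ x, P' (σ.app x)) :
    postcomp A F hF ⟶ proj A P ⋙ constant A P' d where
  app x := homOfNatTrans (q := (Functor.const _).obj d)
    { app := fun X => σ.app (x.diag.obj X)
      naturality := fun _ _ _ => σ.naturality _ } (fun _ => hσ _)
  naturality _ _ f := homOfNatTrans_naturality f.base (q' := (Functor.const _).obj d)
    fun X => σ.naturality (f.trans.app X)

end SliceDiagram
end

/-! ### Slices of the second projection -/

section

/-- A universal arrow at each object suffices: the right adjoint is given on objects only, and no
functoriality has to be checked. -/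
lemma isLeftAdjoint_of_existsUnique {C C' : Type*} [Category C] [Category C'] (M : C ⥤ C')
    (N : C' → C) (ε : ∀ z, M.obj (N z) ⟶ z)
    (h : ∀ (y : C) (z : C') (g : M.obj y ⟶ z), ∃! k : y ⟶ N z, M.map k ≫ ε z = g) :
    M.IsLeftAdjoint := by
  refine isLeftAdjoint_iff_hasTerminal_costructuredArrow.mpr fun z => ?_
  have t : Limits.IsTerminal (CostructuredArrow.mk (ε z)) :=
    Limits.IsTerminal.ofUniqueHom
      (fun y => CostructuredArrow.homMk (h y.left z y.hom).choose (h y.left z y.hom).choose_spec.1)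
      (fun y k => CostructuredArrow.hom_ext _ _ ((h y.left z y.hom).unique
        (CostructuredArrow.w k) (h y.left z y.hom).choose_spec.1))
  exact t.hasTerminal

namespace SliceDiagram

variable {A : Type u} [SmallCategory A] {I D : Type u} [SmallCategory I] [SmallCategory D]
  {s : Prop}

/-- Composition with the first projection, on slices of the composition with the second
projection. -/
def sliceFst (x : SliceDiagram A (isos s D)) :
    CostructuredArrow (postcomp A (P := isos s (I × D)) (CategoryTheory.Prod.snd I D)
      (isos_map _)) x ⥤
      CostructuredArrow (proj A (isos s I)) x.base where
  obj y := CostructuredArrow.mk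
    (Y := (postcomp A (P := isos s (I × D)) (P' := isos s I) (CategoryTheory.Prod.fst I D)
      (isos_map _)).obj y.left)
    y.hom.base
  map {_ _} f := CostructuredArrow.homMk
    ((postcomp A (CategoryTheory.Prod.fst I D) (isos_map _)).map f.left)
    (congrArg Hom.base (CostructuredArrow.w f))
  map_id y := CostructuredArrow.hom_ext _ _
    ((postcomp A (CategoryTheory.Prod.fst I D) (isos_map _)).map_id y.left)
  map_comp f g := CostructuredArrow.hom_ext _ _
    ((postcomp A (CategoryTheory.Prod.fst I D) (isos_map _)).map_comp f.left g.left)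

/-- The restriction of a diagram, as an object of a slice. -/
def prodRestrict (x : SliceDiagram A (isos s D))
    (z : CostructuredArrow (proj A (isos s I)) x.base) :
    CostructuredArrow (postcomp A (P := isos s (I × D)) (CategoryTheory.Prod.snd I D)
      (isos_map _)) x :=
  CostructuredArrow.mk (S := postcomp A (P := isos s (I × D)) (CategoryTheory.Prod.snd I D)
      (isos_map _))
    -- The second coordinate is the restriction of x itself, so the structural morphism to x can
    -- have identity components.
    (Y := (⟨z.left.base, z.left.diag.prod' (Over.map z.hom ⋙ x.diag)⟩ : SliceDiagram A _))
    { base := z.hom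
      trans := 
        { app := fun _ => 𝟙 _
          naturality := fun _ _ _ => (Category.comp_id _).trans (Category.id_comp _).symm }
      prop := fun _ => (isos s D).id_mem _ }

/-- The morphism `h ≫ k ⟶ (h ≫ f) ≫ g` of `A/c` given by an equality `f ≫ g = k`. -/
def factorHom {a b c : A} {f : a ⟶ b} {g : b ⟶ c} {k : a ⟶ c} (h : f ≫ g = k) (X : Over a) :
    (Over.map k).obj X ⟶ (Over.map g).obj ((Over.map f).obj X) :=
  Over.homMk (𝟙 _) (by simp [h])

lemma factorHom_eq {a b c : A} {f : a ⟶ b} {g : b ⟶ c} {k : a ⟶ c} (h : f ≫ g = k) (X : Over a) :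
    factorHom h X = eqToHom (by subst h; rw [Over.mapComp_eq]; rfl) := by
  ext
  simp [Over.eqToHom_left, factorHom]

lemma assocHom_factorHom {a b c : A} {f : a ⟶ b} {g : b ⟶ c} {k : a ⟶ c} (h : f ≫ g = k)
    (X : Over a) : (assocHom f g X ≫ congrHom h X) ≫ factorHom h X = 𝟙 _ := by
  ext
  simp [factorHom]

lemma factorHom_assocHom {a b c : A} {f : a ⟶ b} {g : b ⟶ c} {k : a ⟶ c} (h : f ≫ g = k)
    (X : Over a) : factorHom h X ≫ assocHom f g X ≫ congrHom h X = 𝟙 _ := by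
  ext
  simp [factorHom]

lemma factorHom_naturality {a b c : A} {f : a ⟶ b} {g : b ⟶ c} {k : a ⟶ c} (h : f ≫ g = k)
    {X Y : Over a} (u : X ⟶ Y) : (Over.map k).map u ≫ factorHom h Y =
      factorHom h X ≫ (Over.map g).map ((Over.map f).map u) := by
  ext
  simp [factorHom]

lemma isos_map_factorHom {a b c : A} {f : a ⟶ b} {g : b ⟶ c} {k : a ⟶ c} (h : f ≫ g = k)
    (X : Over a) (p : Over c ⥤ D) : isos s D (p.map (factorHom h X)) := by
  rw [factorHom_eq, eqToHom_map]
  exact eqToHom_mem _ _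

lemma comp_map_cancel {C : Type*} [Category C] (F : C ⥤ D) {x y z : C} {w : D} {k : w ⟶ F.obj x}
    {f : x ⟶ y} {g : y ⟶ z} {h : z ⟶ x} (e : (f ≫ g) ≫ h = 𝟙 x) :
    k = ((k ≫ 𝟙 _ ≫ F.map f) ≫ F.map g) ≫ F.map h := by
  rw [Category.id_comp, Category.assoc, Category.assoc, ← Functor.map_comp, ← Functor.map_comp,
    ← Category.assoc, e]
  simp

lemma comp_map_cancel' {C : Type*} [Category C] (F : C ⥤ D) {x y z : C} {w : D} {k : w ⟶ F.obj x}
    {f : x ⟶ y} {g : y ⟶ z} {h : z ⟶ x} (e : f ≫ g ≫ h = 𝟙 x) :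
    ((k ≫ F.map f) ≫ 𝟙 _ ≫ F.map g) ≫ F.map h = k := by
  rw [Category.id_comp, Category.assoc, Category.assoc, ← Functor.map_comp, ← Functor.map_comp, e]
  simp

/-- The structural morphism of `prodRestrict x z` has identity components, so compatibility with the
structural morphisms to x leaves no freedom in the second coordinate. -/
lemma hom_prodRestrict {x : SliceDiagram A (isos s D)}
    {y : CostructuredArrow (postcomp A (P := isos s (I × D)) (CategoryTheory.Prod.snd I D)
      (isos_map _)) x}
    {z : CostructuredArrow (proj A (isos s I)) x.base} (k : y ⟶ prodRestrict x z)
    (h : k.left.base ≫ z.hom = y.hom.base) (X : Over y.left.base) :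
    (k.left.trans.app X).2 = y.hom.trans.app X ≫ x.diag.map (factorHom h X) := by
  have h1 := trans_app_congr (CostructuredArrow.w k) X
  have h2 : (((k.left.trans.app X).2 ≫ 𝟙 _ ≫ x.diag.map (assocHom k.left.base z.hom X)) ≫
    x.diag.map (congrHom h X) : _ ⟶ _) = y.hom.trans.app X := h1
  rw [← h2]
  exact comp_map_cancel x.diag (assocHom_factorHom h X)

/-- A morphism to `prodRestrict x z` over x is determined by its first coordinate, which is
arbitrary, since the second is forced by the structural morphism. Hence `prodRestrict x` is the
right adjoint on objects, and the slices of the second projection become comparable with those of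
`proj`. -/
instance (x : SliceDiagram A (isos s D)) : (sliceFst (I := I) x).IsLeftAdjoint := by
  refine isLeftAdjoint_of_existsUnique _ (prodRestrict x) (fun z => 𝟙 z) fun y z g => ?_
  let b : y.left.base ⟶ z.left.base := g.left.base
  have hb : b ≫ z.hom = y.hom.base := CostructuredArrow.w g
  let σ (X : Over y.left.base) : (y.left.diag.obj X).1 ⟶ z.left.diag.obj ((Over.map b).obj X) :=
    g.left.trans.app X
  let τ (X : Over y.left.base) : (y.left.diag.obj X).2 ⟶ x.diag.obj ((Over.map y.hom.base).obj X) :=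
    y.hom.trans.app X
  have hσ {X Y : Over y.left.base} (u : X ⟶ Y) : (y.left.diag.map u).1 ≫ σ Y =
    σ X ≫ z.left.diag.map ((Over.map b).map u) := g.left.trans.naturality u
  have hτ {X Y : Over y.left.base} (u : X ⟶ Y) : (y.left.diag.map u).2 ≫ τ Y =
    τ X ≫ x.diag.map ((Over.map y.hom.base).map u) := y.hom.trans.naturality u
  refine ⟨CostructuredArrow.homMk
    { base := b
      trans :=
        { app := fun X => (σ X, τ X ≫ x.diag.map (factorHom hb X))
          naturality := fun X Y u => Prod.ext (hσ u) (by
            refine ((Category.assoc _ _ _).symm.trans (congrArg (· ≫ _) (hτ u))).trans ?_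
            refine (Category.assoc _ _ _).trans (Eq.trans ?_ (Category.assoc _ _ _).symm)
            exact congrArg (τ X ≫ ·) (((x.diag.map_comp _ _).symm.trans
              (congrArg x.diag.map (factorHom_naturality hb u))).trans (x.diag.map_comp _ _))) }
      prop := fun X => isos_prod _ (g.left.prop X) ((isos s D).comp_mem _ _ (y.hom.prop X)
        (isos_map_factorHom hb X x.diag)) } ?_, ?_, fun k hk => ?_⟩
  · refine hom_ext hb fun X => ?_
    exact comp_map_cancel' x.diag (factorHom_assocHom hb X)
  · exact Category.comp_id (Y := z) _
  · obtain rfl : (sliceFst x).map k = g := (Category.comp_id (Y := z) _).symm.trans hk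
    refine CostructuredArrow.hom_ext _ _ (hom_ext rfl fun X => ?_)
    refine (congrArg (_ ≫ ·) ((prodRestrict x z).left.diag.map_id _)).trans
      ((Category.comp_id _).trans (Prod.ext rfl ?_))
    exact hom_prodRestrict k hb X

end SliceDiagram
end

/-! ### Contraction of diagrams with values in a category with a terminal object -/

section

/-- The poset `{0 < 1}`, in an arbitrary universe. -/
def Interval : Type u := ULift.{u} (Fin 2)

namespace Interval

instance : PartialOrder Interval := inferInstanceAs (PartialOrder (ULift (Fin 2)))

/-- The end points of the interval. -/
def point (i : Fin 2) : Interval := ULift.up i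

instance : OrderTop Interval where
  top := point 1
  le_top := fun ⟨i⟩ => Fin.le_last i

instance : Limits.HasTerminal Interval :=
  Limits.IsTerminal.hasTerminal (Limits.IsTerminal.ofUniqueHom (Y := (⊤ : Interval))
    (fun _ => homOfLE le_top) (fun _ _ => Subsingleton.elim _ _))

/-- The functor to the category `Fin 2`. -/
def toFin : Interval.{u} ⥤ Fin 2 :=
  Monotone.functor (f := ULift.down) (fun _ _ h => h)

end Interval

variable {D : Type u} [SmallCategory D]

/-- The natural transformation from the identity to a constant functor at a terminal object. -/
def toTerminal {t : D} (ht : Limits.IsTerminal t) : 𝟭 D ⟶ (Functor.const D).obj t where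
  app x := ht.from x

/-- The homotopy from the identity to a constant functor at a terminal object. -/
def contraction {t : D} (ht : Limits.IsTerminal t) : Interval.{u} × D ⥤ D :=
  Functor.uncurry.obj (Interval.toFin ⋙ ComposableArrows.mk₁ (toTerminal ht))

/-- The inclusion of `D` in `I × D` at an end point. -/
abbrev inclusion (D : Type u) [SmallCategory D] (i : Fin 2) : D ⥤ Interval.{u} × D :=
  Prod.sectR (Interval.point i) D

/-- The comparison of the homotopy at `0` with the identity. -/
def contractionZero {t : D} (ht : Limits.IsTerminal t) : inclusion D 0 ⋙ contraction ht ⟶ 𝟭 D where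
  app x := 𝟙 x
  naturality x y f := by
    refine (Category.comp_id _).trans (Eq.trans ?_ (Category.id_comp _).symm)
    have h := (Interval.toFin.{u} ⋙ ComposableArrows.mk₁ (toTerminal ht)).map_id
      (Interval.point 0)
    exact (congrArg (fun k => k.app x ≫ f) h).trans (Category.id_comp f)

/-- The comparison of the homotopy at `1` with the constant functor. -/
def contractionOne {t : D} (ht : Limits.IsTerminal t) :
    inclusion D 1 ⋙ contraction ht ⟶ (Functor.const D).obj t where
  app _ := 𝟙 t
  naturality _ _ _ := ht.hom_ext _ _

variable {W : MorphismProperty Cat.{u, u}} {A : Type u}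
  [SmallCategory A] {s : Prop}

namespace SliceDiagram

/-- The projection from diagrams on slices with values in `D` is a weak equivalence if `D` has a
terminal object and if the same projection is aspherical for the interval. -/
lemma proj_mem (hW : IsBasicLocalizer W)
    (h : IsAsphericalFunctor W (proj A (isos s Interval.{u}))) [Limits.HasTerminal D] :
    W (proj A (isos s D)).toCatHom := by
  -- The slice over x is related by the left adjoint `sliceFst x` to the slice of the interval
  -- projection over the base of x, which is aspherical by hypothesis.
  have hp : W (postcomp A (P := isos s (Interval.{u} × D)) (CategoryTheory.Prod.snd _ D)
      (isos_map _)).toCatHom :=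
    hW.mem_of_isAsphericalFunctor fun x => (hW.isAspherical_congr (sliceFst x)).mpr (h x.base)
  -- Both end-point inclusions are sections of the second projection, up to a natural
  -- transformation.
  have hi (i : Fin 2) : W (postcomp A (P := isos s D) (inclusion D i) (isos_map _)).toCatHom := by
    refine hW.of_comp_right hp ((hW.mem_iff_of_natTrans (G := 𝟭 _) ?_).mpr (hW.id_mem _))
    exact
      { app := fun x => homOfNatTrans (𝟙 x.diag) (fun X => (isos s D).id_mem _)
        naturality := fun x y f => homOfNatTrans_naturality f.base fun X =>
          (Category.comp_id _).trans (Category.id_comp _).symm }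
  let t := Limits.terminalIsTerminal (C := D)
  -- At the end point 0 the homotopy is the identity, so two-out-of-three applies.
  have hh : W (postcomp A (P' := isos s D) (contraction t) (isos_map _)).toCatHom := by
    refine hW.of_comp_left (hi 0) ((hW.mem_iff_of_natTrans (G := 𝟭 _) ?_).mpr (hW.id_mem _))
    exact
      { app := fun x => homOfNatTrans (Functor.whiskerLeft x.diag (contractionZero t))
          (fun X => (isos s D).id_mem _)
        naturality := fun x y f => homOfNatTrans_naturality f.base fun X =>
          (contractionZero t).naturality (f.trans.app X) }
  have h1 := hW.comp_mem (hi 1) hh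
  -- At the end point 1 the homotopy is constant at the terminal object, so `h1` transfers to the
  -- projection followed by the constant section. The retraction axiom then gives the projection
  -- itself.
  refine hW.retraction_mem' (constant_comp_proj (⊤_ D)) ((hW.mem_iff_of_natTrans ?_).mp h1)
  exact postcompConst (⊤_ D) (inclusion D 1 ⋙ contraction t) (isos_map _) (contractionOne t)
    (fun x => (isos s D).id_mem _)

end SliceDiagram
end

/-! ### Asphericity of categories of diagrams -/

section

variable {W : MorphismProperty Cat.{u, u}} {A : Type u} [SmallCategory A] {s : Prop}

variable (W A s) in
/-- Diagrams on slices with values in a category with a terminal object form an aspherical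
category. -/
def HasAsphericalDiagrams : Prop :=
  ∀ (D : Type u) [SmallCategory D] [Limits.HasTerminal D],
    IsAspherical W (SliceDiagram A (isos s D))

variable (W A) in
/-- Diagrams on the iterated slices of `A` with values in the interval form an aspherical
category. -/
def IsLocallyAspherical : Prop :=
  ∀ a : A, IsAspherical W (SliceDiagram (Over a) (isos False Interval.{u}))

namespace SliceDiagram

lemma isAspherical_congr_property {D : Type u} [SmallCategory D] {P P' : MorphismProperty D}
    [P.IsMultiplicative] [P'.IsMultiplicative] (h : P = P') :
    IsAspherical W (SliceDiagram A P) ↔ IsAspherical W (SliceDiagram A P') := by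
  subst h
  rfl

/-- The slice of `proj` over a is equivalent to diagrams on A/a, and for the interval the parameter
`s` plays no role. -/
lemma isAsphericalFunctor_proj_iff (hW : IsBasicLocalizer W) (s : Prop) :
    IsAsphericalFunctor W (proj A (isos s Interval.{u})) ↔ IsLocallyAspherical W A := by
  refine forall_congr' fun a => ?_
  rw [hW.isAspherical_congr (sliceProj (isos s Interval.{u}) a)]
  exact isAspherical_congr_property (isos_partialOrder Interval)

/-- An iterated slice (A/a)/b is a slice of A, so the condition on A/a is part of the condition on
A. -/
lemma isLocallyAspherical_over (hW : IsBasicLocalizer W) (h : IsLocallyAspherical W A) (a : A) :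
    IsLocallyAspherical W (Over a) := by
  rw [← isAsphericalFunctor_proj_iff hW False] at h ⊢
  intro b
  rw [← hW.isAspherical_congr
    (CostructuredArrow.pre (sliceProj (isos False Interval.{u}) a) (proj (Over a) _) b)]
  exact (hW.isAspherical_congr
    (CostructuredArrow.preEquivalence (proj A (isos False Interval.{u}))
      (G := 𝟭 A) (e := a) b).functor).mpr (h b.left)

end SliceDiagram

open SliceDiagram

lemma IsLocallyAspherical.isAspherical_iff (hW : IsBasicLocalizer W) (h : IsLocallyAspherical W A)
    (D : Type u) [SmallCategory D] [Limits.HasTerminal D] :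
    IsAspherical W (SliceDiagram A (isos s D)) ↔ IsAspherical W A :=
  hW.isAspherical_iff (proj_mem hW ((isAsphericalFunctor_proj_iff hW s).mpr h))

lemma IsLocallyAspherical.hasAsphericalDiagrams_iff (hW : IsBasicLocalizer W)
    (h : IsLocallyAspherical W A) : HasAsphericalDiagrams W A s ↔ IsAspherical W A :=
  ⟨fun h' => (h.isAspherical_iff hW Interval).mp (h' Interval),
    fun h' D _ _ => (h.isAspherical_iff hW D).mpr h'⟩

/-- One direction specializes to the interval, which has a terminal object. The other uses that A/a
inherits local asphericity and is aspherical because it has a terminal object. -/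
lemma isLocallyAspherical_iff (hW : IsBasicLocalizer W) (s : Prop) :
    (∀ a : A, HasAsphericalDiagrams W (Over a) s) ↔ IsLocallyAspherical W A := by
  refine ⟨fun h a => ?_, fun h a => ?_⟩
  · exact (isAspherical_congr_property (isos_partialOrder Interval)).mp (h a Interval)
  · exact ((isLocallyAspherical_over hW h a).hasAsphericalDiagrams_iff hW).mpr
      (hW.toPoint_mem _ inferInstance)

/-- The evaluation functors are weak equivalences as soon as diagrams with values in a category
with a terminal object form an aspherical category. -/
lemma eval_mem_iff (hW : IsBasicLocalizer W) :
    (∀ C : Cat.{u, u}, W (eval A (isos s C)).toCatHom) ↔ HasAsphericalDiagrams W A s := by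
  refine ⟨fun h D _ hD => (hW.isAspherical_iff (h (Cat.of D))).mpr (hW.toPoint_mem D hD),
    fun h C => hW.mem_of_isAsphericalFunctor fun c => ?_⟩
  have : ((isos s C).inverseImage (Over.forget c)).IsMultiplicative := by
    rw [← isos_over]
    infer_instance
  -- The slice over c is the category of diagrams with values in C/c, which has the terminal object
  -- 𝟙 c.
  exact (hW.isAspherical_congr (sliceEval (isos s C) c)).mpr
    ((isAspherical_congr_property (isos_over c)).mp (h (Over c)))

end

/-! ### Comparison with the categories of elements -/

section

variable {A : Type u} [SmallCategory A]

namespace SliceDiagram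

lemma eq_of_comp_eqToHom {C : Type*} [Category C] {w x y z : C} (h : w = x) (h' : y = z)
    {f : w ⟶ y} {g : x ⟶ z} (e : f ≫ eqToHom h' = eqToHom h ≫ g) :
    f = eqToHom h ≫ g ≫ eqToHom h'.symm := by
  subst h h'
  simpa using e

lemma eqToHom_app_mem {C D : Type*} [Category C] [Category D] {s : Prop} {F G : C ⥤ D} (h : F = G)
    (X : C) : isos s D ((eqToHom h).app X) := by
  subst h
  exact (isos s D).id_mem _

/-- Naturality of a transformation whose components are identities says exactly that the two
functors agree on morphisms as well as on objects. -/
lemma eq_of_isos {C : Type u} [SmallCategory C] {x y : SliceDiagram A (isos True C)} (f : Hom x y) :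
    x.diag = Over.map f.base ⋙ y.diag :=
  CategoryTheory.Functor.ext (fun X => ((f.prop X).2 trivial).choose) (fun X Y u => by
    have h := f.trans.naturality u
    rw [((f.prop X).2 trivial).choose_spec, ((f.prop Y).2 trivial).choose_spec] at h
    exact eq_of_comp_eqToHom _ _ h)

lemma trans_eq_of_isos {C : Type u} [SmallCategory C] {x y : SliceDiagram A (isos True C)}
    (f : Hom x y) : f.trans = eqToHom (eq_of_isos f) := by
  ext X
  rw [((f.prop X).2 trivial).choose_spec, eqToHom_app]

/-- The comparison of diagrams on slices, with identities as transition morphisms, with the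
category of elements of `i_A^* C`. -/
def toElements (A : Type u) [SmallCategory A] (C : Cat.{u, u}) :
    SliceDiagram A (isos True C) ⥤ ((iAStar A).obj C).Elementsᵒᵖ where
  obj x := op ⟨op x.base, x.diag.toCatHom⟩
  map {_ _} f := Quiver.Hom.op (CategoryOfElements.homMk _ _ f.base.op
    (congrArg Functor.toCatHom (eq_of_isos f)).symm)
  map_id _ := rfl
  map_comp _ _ := rfl

/-- When the transition components are identities, a morphism is determined by its base. -/
instance (C : Cat.{u, u}) : (toElements A C).Faithful where
  map_injective {x y f g} h := by
    have hb : f.base = g.base := congrArg (fun k => k.unop.val.unop) h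
    refine hom_ext hb fun X => ?_
    rw [((f.prop X).2 trivial).choose_spec, ((g.prop X).2 trivial).choose_spec]
    have : congrHom hb X = eqToHom (by rw [hb]) := by
      ext
      simp [Over.eqToHom_left]
    rw [this, eqToHom_map]
    exact eqToHom_trans _ _

instance (C : Cat.{u, u}) : (toElements A C).Full where
  map_surjective {x y} f := by
    have h : x.diag = Over.map f.unop.val.unop ⋙ y.diag := sliceFunctor_eq f
    exact ⟨
      { base := f.unop.val.unop
        trans := eqToHom h
        prop := fun X => eqToHom_app_mem h X }, rfl⟩

instance (C : Cat.{u, u}) : (toElements A C).EssSurj where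
  mem_essImage z := ⟨⟨z.unop.1.unop, sliceFunctor z.unop.2⟩, ⟨Iso.refl _⟩⟩

instance (C : Cat.{u, u}) : (toElements A C).IsEquivalence where

/-- The comparison of the evaluation functor with the counit of `i_A ⊣ i_A^*`. -/
def toElementsCounit (C : Cat.{u, u}) :
    eval A (isos True C) ⟶ toElements A C ⋙ iACounitFunctor C where
  app x := 𝟙 _
  naturality x y f := by
    refine (Category.comp_id _).trans (Eq.trans ?_ (Category.id_comp _).symm)
    exact congrArg (evalMap f.base) (trans_eq_of_isos f)

/-- The transition morphism of a morphism of diagrams, as an isomorphism. -/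
def transIso {C : Type u} [SmallCategory C] {s : Prop} {x y : SliceDiagram A (isos s C)}
    (f : Hom x y) : x.diag ≅ Over.map f.base ⋙ y.diag :=
  NatIso.ofComponents (fun X => @asIso _ _ _ _ (f.trans.app X) (f.prop X).1)
    (fun u => f.trans.naturality u)

/-- Together with `comp_trans`, this puts the structural morphisms in the `eqToHom` form in which
`GrpdElements` expresses its identities and composites. -/
lemma id_trans {C : Type u} [SmallCategory C] {P : MorphismProperty C} [P.IsMultiplicative]
    (x : SliceDiagram A P) :
    Hom.trans (𝟙 x) = eqToHom (by rw [id_base, Over.mapId_eq]; rfl) := by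
  ext X
  rw [eqToHom_app]
  refine (congrArg x.diag.map (unitHom_eq X)).trans ?_
  exact eqToHom_map _ _

lemma comp_trans {C : Type u} [SmallCategory C] {P : MorphismProperty C} [P.IsMultiplicative]
    {x y z : SliceDiagram A P} (f : x ⟶ y) (g : y ⟶ z) :
    Hom.trans (f ≫ g) = f.trans ≫ (Over.map f.base).whiskerLeft g.trans ≫
      eqToHom (by rw [comp_base, Over.mapComp_eq]; rfl) := by
  ext X
  simp only [NatTrans.comp_app, eqToHom_app]
  refine congrArg (fun k => _ ≫ _ ≫ k) ?_
  refine (congrArg z.diag.map (assocHom_eq _ _ X)).trans ?_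
  exact eqToHom_map _ _

lemma core_hom_ext {C : Type*} [Category C] {x y : Core C} {f g : x ⟶ y}
    (h : f.iso.hom = g.iso.hom) : f = g :=
  CoreHom.ext (Iso.ext h)

/-- The comparison of diagrams on slices, with isomorphisms as transition morphisms, with the
category of elements of `I_A^* C`. -/
def toGrpdElements (A : Type u) [SmallCategory A] (C : Cat.{u, u}) :
    SliceDiagram A (isos False C) ⥤ GrpdElements ((IAStar A).obj C) where
  obj x := ⟨x.base, Core.mk x.diag⟩
  map {x y} f := ⟨f.base, CoreHom.mk (transIso f)⟩
  map_id x := GrpdElements.hom_ext rfl ((Category.comp_id _).trans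
    (core_hom_ext ((id_trans x).trans (core_eqToHom_hom (D := Over x.base ⥤ C)
      (x := Core.mk x.diag) (y := Core.mk (Over.map (𝟙 x.base) ⋙ x.diag))
      (by rw [Over.mapId_eq]; rfl)).symm)))
  map_comp {x y z} f g := GrpdElements.hom_ext rfl ((Category.comp_id _).trans
    (core_hom_ext ((comp_trans f g).trans (congrArg
      (fun k => f.trans ≫ (Over.map f.base).whiskerLeft g.trans ≫ k)
      (core_eqToHom_hom (D := Over x.base ⥤ C) _).symm))))

/-- The comparison functor with the category of elements of `I_A^* C` is fully faithful. -/
def fullyFaithfulToGrpdElements (C : Cat.{u, u}) : (toGrpdElements A C).FullyFaithful where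
  preimage {_ _} f :=
    { base := f.base
      trans := f.fiber.iso.hom
      prop := fun X => ⟨(f.fiber.iso.app X).isIso_hom, False.elim⟩ }
  map_preimage _ := GrpdElements.hom_ext rfl ((Category.comp_id _).trans (core_hom_ext rfl))
  preimage_map _ := rfl

instance (C : Cat.{u, u}) : (toGrpdElements A C).EssSurj where
  mem_essImage z := ⟨⟨z.base, z.fiber.of⟩, ⟨Iso.refl _⟩⟩

instance (C : Cat.{u, u}) : (toGrpdElements A C).IsEquivalence where
  faithful := (fullyFaithfulToGrpdElements C).faithful
  full := (fullyFaithfulToGrpdElements C).full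

/-- The comparison of the evaluation functor with the counit of `I_A ⊣ I_A^*`. -/
def toGrpdElementsCounit (C : Cat.{u, u}) :
    eval A (isos False C) ⟶ toGrpdElements A C ⋙ IACounitFunctor C where
  app _ := 𝟙 _
  naturality _ _ _ := (Category.comp_id _).trans (Category.id_comp _).symm

end SliceDiagram

open SliceDiagram

/-! ### Characterizations of weak test, local test and test categories -/

variable {W : MorphismProperty Cat.{u, u}}

/-- Transfers membership in W from the counit to `eval`: the comparison is an equivalence, hence in
W, and the triangle needs to commute only up to a natural transformation. -/
lemma counit_mem_iff (hW : IsBasicLocalizer W) {E C D : Type u} [SmallCategory C] [SmallCategory D]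
    [SmallCategory E] (F : C ⥤ D) [F.IsEquivalence] (G : D ⥤ E) (H : C ⥤ E) (α : H ⟶ F ⋙ G) :
    W G.toCatHom ↔ W H.toCatHom := by
  rw [hW.mem_iff_of_natTrans α]
  exact ⟨hW.comp_mem (hW.mem_of_isLeftAdjoint F), hW.of_comp_left (hW.mem_of_isLeftAdjoint F)⟩

lemma isWeakTest_iff (hW : IsBasicLocalizer W) :
    IsWeakTest W A ↔ HasAsphericalDiagrams W A True := by
  have : W.ContainsIdentities := ⟨fun X => hW.iso_mem _ inferInstance⟩
  rw [← eval_mem_iff hW]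
  refine (isHomotopicalEquivalence_iff hW.twoOutOfThree (iAAdj A)).trans (forall_congr' fun C => ?_)
  exact counit_mem_iff hW (toElements A C) (iACounitFunctor C) _ (toElementsCounit C)

lemma isGroupoidalWeakTest_iff (hW : IsBasicLocalizer W) :
    IsGroupoidalWeakTest W A ↔ HasAsphericalDiagrams W A False := by
  have : W.ContainsIdentities := ⟨fun X => hW.iso_mem _ inferInstance⟩
  rw [← eval_mem_iff hW]
  refine (isHomotopicalEquivalence_iff hW.twoOutOfThree (IAAdj A)).trans (forall_congr' fun C => ?_)
  exact counit_mem_iff hW (toGrpdElements A C) (IACounitFunctor C) _ (toGrpdElementsCounit C)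

lemma isLocalTest_iff (hW : IsBasicLocalizer W) : IsLocalTest W A ↔ IsLocallyAspherical W A :=
  (forall_congr' fun _ => isWeakTest_iff hW).trans (isLocallyAspherical_iff hW True)

lemma isGroupoidalLocalTest_iff (hW : IsBasicLocalizer W) :
    IsGroupoidalLocalTest W A ↔ IsLocallyAspherical W A :=
  (forall_congr' fun _ => isGroupoidalWeakTest_iff hW).trans (isLocallyAspherical_iff hW False)

lemma isGroupoidalTest_iff_isTest (hW : IsBasicLocalizer W) :
    IsGroupoidalTest W A ↔ IsTest W A := by
  -- The weak test conditions are compared only under local asphericity, where both reduce to the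
  -- asphericity of A.
  have key (h : IsLocallyAspherical W A) : IsGroupoidalWeakTest W A ↔ IsWeakTest W A := by
    rw [isGroupoidalWeakTest_iff hW, isWeakTest_iff hW, h.hasAsphericalDiagrams_iff hW,
      h.hasAsphericalDiagrams_iff hW]
  have h := isGroupoidalLocalTest_iff (A := A) hW
  have h' := isLocalTest_iff (A := A) hW
  exact ⟨fun ⟨h1, h2⟩ => ⟨(key (h.mp h2)).mp h1, h'.mpr (h.mp h2)⟩,
    fun ⟨h1, h2⟩ => ⟨(key (h'.mp h2)).mpr h1, h.mpr (h'.mp h2)⟩⟩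

end

end

end TestCat

theorem mainTheorem1 (W : MorphismProperty Cat.{u, u}) (hW : TestCat.IsBasicLocalizer W)
    (A : Type u) [SmallCategory A] :
    (TestCat.IsGroupoidalLocalTest W A ↔ TestCat.IsLocalTest W A) ∧
    (TestCat.IsGroupoidalTest W A ↔ TestCat.IsTest W A) ∧
    (TestCat.IsGroupoidalStrictTest W A ↔ TestCat.IsStrictTest W A) := by
  have h := TestCat.isGroupoidalTest_iff_isTest (A := A) hW
  exact ⟨(TestCat.isGroupoidalLocalTest_iff hW).trans (TestCat.isLocalTest_iff hW).symm, h,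
    fun ⟨h1, h2⟩ => ⟨h1, h.mp h2⟩, fun ⟨h1, h2⟩ => ⟨h1, h.mpr h2⟩⟩
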